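/- **Setting.** Let $U$ be a finite set of $n$ users and $R$ a finite set of $k$ resources. For a relation $A\subseteq U\times R$ and $r\in R$ put $A(r)=\{u\in U:(u,r)\in A\}$. A base relation is a relation $A_{\mathsf{Bse}}\subseteq U\times R$ with $A_{\mathsf{Bse}}(r)\neq\emptyset$ for all $r\in R$. A universal separation-of-duty constraint $(r,r',\updownarrow,\forall)$ with $r,r'\in R$ is satisfied by $A$ if every $u\in A(r)\cup A(r')$ lies in exactly one of $A(r)$ and $A(r')$, that is, if $A(r)\cap A(r')=\emptyset$. An instance consists of $U$, $R$, a base relation $A_{\mathsf{Bse}}$ and a finite set $C$ of universal separation-of-duty constraints; its size is $N=|U|+|R|+|A_{\mathsf{Bse}}|+|C|$. A relation $A$ is valid if $A\subseteq A_{\mathsf{Bse}}$, $A(r)\ne\emptyset$ for every $r\in R$, and $A$ satisfies every constraint in $C$. Let $\Pi$ be the set of functions $\pi:R\to U$ whose graph $\{(\pi(r),r):r\in R\}$ is a valid relation. The pattern $P(\pi)$ of $\pi$ is the partition of $R$ into the classes of the equivalence relation $\pi(r)=\pi(r')$. For $\pi\in\Pi$ let $M_\pi$ be the maximum cardinality of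 a valid relation that contains the graph of $\pi$, and for a partition $P$ of $R$ let $M_P=\max\{M_\pi:\pi\in\Pi,\ P(\pi)=P\}$, which is defined if some $\pi\in\Pi$ has pattern $P$. A problem with parameter $k$ is solvable in time $O^*(f(k))$ if there are one algorithm and one polynomial $p$ such that the algorithm solves every instance in time at most $f(k)\,p(N)$. Algorithms are programs of a random access machine (with addition, truncated subtraction, multiplication, integer division, indirect addressing, branching and loops) and time is measured by logarithmic cost. Logarithms are to base $2$, and $0\log 0=0$. **Theorem.** 1. (maxAPEP$\langle\mathsf{SoD_U}\rangle$) Given an instance, a valid relation of maximum cardinality can be found, or it can be reported that no valid relation exists, in time $O^*(2^{k+k\log k})$. 2. (D-APEP$\langle\mathsf{SoD_U}\rangle$) Given an instance, a valid relation can be found, or it can be reported that none exists, in time $O^*(2^{k+k\log k})$. 3. Given an instance and a partition $P$ of $R$, a valid relation $A_P$ with $|A_P|=M_P$ can be found, or it can be reported that no $\pi\in\Pi$ has pattern $P$, in time $O^*(2^k)$. -/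

import Mathlib

namespace APEP

/-! ### Authorization relations and constraints -/

section Relations

variable {U R : Type} [Fintype U] [DecidableEq U] [Fintype R] [DecidableEq R]

/-- The set `A(r)` of users authorized for the resource `r`. -/
def usersOf (A : Finset (U × R)) (r : R) : Finset U :=
  Finset.univ.filter fun u => (u, r) ∈ A

/-- The four binary connectives used in constraints. -/
inductive Connective
  | iff
  | imp
  | revImp
  | xor
  deriving DecidableEq

/-- The truth tables of the connectives. -/
def Connective.eval : Connective → Prop → Prop → Prop
  | .iff, p, q => (p ↔ q)
  | .imp, p, q => (p → q)
  | .revImp, p, q => (q → p)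
  | .xor, p, q => Xor p q

/-- The two quantifiers used in constraints. -/
inductive Quantifier
  | ex
  | all
  deriving DecidableEq

/-- The constraint `(r, r', ∘, Q)`. -/
structure Constraint (R : Type) where
  fst : R
  snd : R
  conn : Connective
  quant : Quantifier
  deriving DecidableEq

/-- The relation `A` satisfies the constraint: some (every) user `u ∈ A(r) ∪ A(r')` makes
`(u ∈ A(r)) ∘ (u ∈ A(r'))` true. -/
def Satisfies (A : Finset (U × R)) (c : Constraint R) : Prop :=
  match c.quant with
  | .ex => ∃ u ∈ usersOf A c.fst ∪ usersOf A c.snd,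
      c.conn.eval (u ∈ usersOf A c.fst) (u ∈ usersOf A c.snd)
  | .all => ∀ u ∈ usersOf A c.fst ∪ usersOf A c.snd,
      c.conn.eval (u ∈ usersOf A c.fst) (u ∈ usersOf A c.snd)

/-- The family of universal separation-of-duty constraints `(r, r', xor, ∀)`. -/
def SoDU (R : Type) : Set (Constraint R) :=
  {c | c.conn = .xor ∧ c.quant = .all}

def Authorized (base A : Finset (U × R)) : Prop := A ⊆ base

def Complete (A : Finset (U × R)) : Prop := ∀ r : R, (usersOf A r).Nonempty

def Eligible (C : Finset (Constraint R)) (A : Finset (U × R)) : Prop :=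
  ∀ c ∈ C, Satisfies A c

/-- Valid relations: authorized, complete and eligible. -/
def Valid (base : Finset (U × R)) (C : Finset (Constraint R)) (A : Finset (U × R)) : Prop :=
  Authorized base A ∧ Complete A ∧ Eligible C A

/-- A function `π : R → U`, seen as an authorization relation. -/
def graph (π : R → U) : Finset (U × R) := Finset.univ.image fun r => (π r, r)

/-- The valid relations that are functions `R → U`. -/
def validPlans (base : Finset (U × R)) (C : Finset (Constraint R)) : Set (R → U) :=
  {π | Valid base C (graph π)}

/-- `A` contains `π`. -/
def Contains (A : Finset (U × R)) (π : R → U) : Prop := ∀ r : R, (π r, r) ∈ A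

/-- The pattern of `π`: the partition of `R` into the classes of `π r = π r'`. -/
def pattern (π : R → U) : Finpartition (Finset.univ : Finset R) :=
  haveI : DecidableRel (Setoid.ker π) := fun r r' => inferInstanceAs (Decidable (π r = π r'))
  Finpartition.ofSetoid (Setoid.ker π)

/-- `M` is the maximum size of a valid relation containing `π`. -/
def IsMaxOfPlan (base : Finset (U × R)) (C : Finset (Constraint R)) (π : R → U) (M : ℕ) : Prop :=
  IsGreatest {m | ∃ A, Valid base C A ∧ Contains A π ∧ A.card = m} M

/-- `M` is the maximum, over the valid functions `π` with pattern `P`, of the maximum size of a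
valid relation containing `π`. -/
def IsMaxOfPattern (base : Finset (U × R)) (C : Finset (Constraint R))
    (P : Finpartition (Finset.univ : Finset R)) (M : ℕ) : Prop :=
  IsGreatest {m | ∃ π ∈ validPlans base C, pattern π = P ∧ IsMaxOfPlan base C π m} M

end Relations

/-! ### Problem instances -/

/-- An instance with users `Fin n` and resources `Fin k`. -/
structure Instance where
  n : ℕ
  k : ℕ
  base : Finset (Fin n × Fin k)
  base_nonempty : ∀ r : Fin k, (usersOf base r).Nonempty
  constraints : Finset (Constraint (Fin k))

/-- The size `|U| + |R| + |A_Bse| + |C|` of an instance. -/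
def Instance.size (I : Instance) : ℕ :=
  I.n + I.k + I.base.card + I.constraints.card

/-- Instances all of whose constraints are universal separation-of-duty constraints. -/
def SoDUInstance : Type := {I : Instance // ∀ c ∈ I.constraints, c ∈ SoDU (Fin I.k)}

/-- A possible answer: an authorization relation, or `none` for "there is none". -/
abbrev Answer (I : Instance) : Type := Option (Finset (Fin I.n × Fin I.k))

/-- Answers to maxAPEP: a valid relation of maximum cardinality if there is a valid one. -/
def IsMaxAnswer (I : Instance) : Answer I → Prop
  | some A => Valid I.base I.constraints A ∧
      ∀ B, Valid I.base I.constraints B → B.card ≤ A.card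
  | none => ∀ B, ¬ Valid I.base I.constraints B

/-- Answers to D-APEP: a valid relation if there is one. -/
def IsDecisionAnswer (I : Instance) : Answer I → Prop
  | some A => Valid I.base I.constraints A
  | none => ∀ B, ¬ Valid I.base I.constraints B

/-- Answers for a given pattern `P`: a valid relation whose size is the maximum belonging to `P`;
`none` if no valid function has pattern `P`. -/
def IsPatternAnswer (I : Instance) (P : Finpartition (Finset.univ : Finset (Fin I.k))) :
    Answer I → Prop
  | some A => Valid I.base I.constraints A ∧ IsMaxOfPattern I.base I.constraints P A.card
  | none => ∀ π ∈ validPlans I.base I.constraints, pattern π ≠ P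

/-! ### Encodings as lists of natural numbers -/

/-- The rows, one after another, of a 0/1-matrix. -/
def encodeMatrix {a b : ℕ} (S : Finset (Fin a × Fin b)) : List ℕ :=
  (List.finRange a).flatMap fun i => (List.finRange b).map fun j => if (i, j) ∈ S then 1 else 0

/-- `n`, `k`, the `n × k` matrix of the base relation, and the `k × k` matrix of the
universal separation-of-duty constraints. -/
def encodeInstance (I : Instance) : List ℕ :=
  [I.n, I.k] ++ encodeMatrix I.base ++
    encodeMatrix (Finset.univ.filter fun p : Fin I.k × Fin I.k =>
      (⟨p.1, p.2, .xor, .all⟩ : Constraint (Fin I.k)) ∈ I.constraints)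

/-- The `k × k` matrix of "lie in the same class". -/
def encodePattern {k : ℕ} (P : Finpartition (Finset.univ : Finset (Fin k))) : List ℕ :=
  encodeMatrix (Finset.univ.filter fun p : Fin k × Fin k => p.2 ∈ P.part p.1)

def encodeAnswer {I : Instance} : Answer I → List ℕ
  | none => [0]
  | some A => 1 :: encodeMatrix A

/-! ### A random access machine with logarithmic cost -/

/-- A memory state: registers `reg 0, reg 1, …` and arrays `arr 0, arr 1, …`, all with natural
number entries. -/
structure State where
  reg : ℕ → ℕ
  arr : ℕ → ℕ → ℕ

/-- Expressions: literals, registers, array entries, and arithmetic. -/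
inductive Expr
  | lit (c : ℕ)
  | var (x : ℕ)
  | get (a : ℕ) (i : Expr)
  | add (e f : Expr)
  | sub (e f : Expr)
  | mul (e f : Expr)
  | div (e f : Expr)

/-- Values; subtraction is truncated at `0`, division rounds down and division by `0` gives `0`. -/
def Expr.eval (σ : State) : Expr → ℕ
  | lit c => c
  | var x => σ.reg x
  | get a i => σ.arr a (i.eval σ)
  | add e f => e.eval σ + f.eval σ
  | sub e f => e.eval σ - f.eval σ
  | mul e f => e.eval σ * f.eval σ
  | div e f => e.eval σ / f.eval σ

/-- Cost of an evaluation, in terms of the bit lengths (`Nat.size`) of all numbers involved. -/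
def Expr.cost (σ : State) : Expr → ℕ
  | lit c => 1 + c.size
  | var x => 1 + (σ.reg x).size
  | get a i => i.cost σ + 1 + (i.eval σ).size + (σ.arr a (i.eval σ)).size
  | add e f => e.cost σ + f.cost σ + 1 + (e.eval σ).size + (f.eval σ).size
  | sub e f => e.cost σ + f.cost σ + 1 + (e.eval σ).size + (f.eval σ).size
  | mul e f => e.cost σ + f.cost σ + (1 + (e.eval σ).size) * (1 + (f.eval σ).size)
  | div e f => e.cost σ + f.cost σ + (1 + (e.eval σ).size) * (1 + (f.eval σ).size)

/-- Programs. -/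
inductive Program
  | skip
  | assign (x : ℕ) (e : Expr)
  | store (a : ℕ) (i e : Expr)
  | seq (c d : Program)
  | cond (e : Expr) (c d : Program)
  | loop (e : Expr) (c : Program)

def State.setReg (σ : State) (x v : ℕ) : State :=
  { σ with reg := Function.update σ.reg x v }

def State.setArr (σ : State) (a i v : ℕ) : State :=
  { σ with arr := Function.update σ.arr a (Function.update (σ.arr a) i v) }

/-- `Exec c σ t τ`: started in the state `σ`, the program `c` halts in the state `τ`, and the run
has cost `t`. In `cond` and `loop`, the test succeeds if the value of the expression is not `0`. -/
inductive Exec : Program → State → ℕ → State → Prop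
  | skip (σ : State) : Exec .skip σ 1 σ
  | assign (σ : State) (x : ℕ) (e : Expr) :
      Exec (.assign x e) σ (1 + e.cost σ) (σ.setReg x (e.eval σ))
  | store (σ : State) (a : ℕ) (i e : Expr) :
      Exec (.store a i e) σ (1 + i.cost σ + e.cost σ) (σ.setArr a (i.eval σ) (e.eval σ))
  | seq {c d : Program} {σ τ ρ : State} {s t : ℕ} (h : Exec c σ s τ) (h' : Exec d τ t ρ) :
      Exec (.seq c d) σ (s + t) ρ
  | condTrue {e : Expr} {c d : Program} {σ τ : State} {t : ℕ} (he : e.eval σ ≠ 0)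
      (h : Exec c σ t τ) : Exec (.cond e c d) σ (1 + e.cost σ + t) τ
  | condFalse {e : Expr} {c d : Program} {σ τ : State} {t : ℕ} (he : e.eval σ = 0)
      (h : Exec d σ t τ) : Exec (.cond e c d) σ (1 + e.cost σ + t) τ
  | loopTrue {e : Expr} {c : Program} {σ τ ρ : State} {s t : ℕ} (he : e.eval σ ≠ 0)
      (h : Exec c σ s τ) (h' : Exec (.loop e c) τ t ρ) :
      Exec (.loop e c) σ (1 + e.cost σ + s + t) ρ
  | loopFalse {e : Expr} {c : Program} {σ : State} (he : e.eval σ = 0) :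
      Exec (.loop e c) σ (1 + e.cost σ) σ

/-- The initial state: the input is in array `0`, its length in register `0`, and all other
entries are `0`. -/
def State.init (input : List ℕ) : State where
  reg x := if x = 0 then input.length else 0
  arr a i := if a = 0 then input.getD i 0 else 0

/-- The output: the first `reg 0` entries of array `0`. -/
def State.output (σ : State) : List ℕ := (List.range (σ.reg 0)).map (σ.arr 0)

/-- On the given input, the program halts with the given output at cost `t`. -/
def Runs (c : Program) (input output : List ℕ) (t : ℕ) : Prop :=
  ∃ τ, Exec c (State.init input) t τ ∧ τ.output = output

/-- The problem with inputs `i : ι` (encoded by `encIn`, of size `size i`, with parameter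
`param i`) and with the correct answers `IsAnswer i` (encoded by `encOut i`) is solved in time
`O*(f(k))`: one program solves all inputs, in time at most `f(param i)` times a polynomial in
`size i`. -/
def SolvableInOStar {ι : Type} {α : ι → Type} (encIn : ι → List ℕ)
    (encOut : (i : ι) → α i → List ℕ) (IsAnswer : (i : ι) → α i → Prop)
    (size param : ι → ℕ) (f : ℕ → ℝ) : Prop :=
  ∃ (c : Program) (p : Polynomial ℕ), ∀ i : ι, ∃ (a : α i) (t : ℕ),
    IsAnswer i a ∧ Runs c (encIn i) (encOut i a) t ∧
      (t : ℝ) ≤ f (param i) * ((p.eval (size i) : ℕ) : ℝ)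

end APEP

/-! One dynamic program over the users serves all three problems. Fix a family of `L` sets of
resources, the cover masks. A relation is covered (`Covers`) if every user can be assigned a cover
mask contained in the row of that user, the set of resources given to them, in such a way that the
assigned masks cover all resources. Authorization and separation of duty restrict each row
separately, and completeness follows from covering. So a largest valid covered relation is found by
adding users one at a time: to cover `S`, the last user takes a cover mask `X` and the best
admissible row containing `X` (`gain`), and the earlier users cover `S \ X` (`best`). This needs `(L
+ 1) * 2 ^ k` steps up to a polynomial factor.

If all `2 ^ k` sets are cover masks, every valid relation is covered, and `4 ^ k` is at most `2 ^ k
* k ^ k` up to a polynomial factor; the same program answers the decision problem. If the cover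
masks are the classes of `P` and the empty set, then `L = k + 1`, and a relation is covered exactly
when it contains some `π` with pattern `P`: a user has only one cover mask, so distinct classes get
distinct users (`covers_of_contains`, `exists_of_covers`). The graph of `π` is then valid, because
the constraints pass to subrelations (`valid_graph`).

No backtracking is needed. A value of the dynamic program carries the cardinality in its leading
binary digits and the relation itself in its last `n * k` digits; the value `0` means infeasible.
The optimum is thus already the answer (`exists_coverAnswer`), and all values have polynomially many
bits (`best_lt`).

The cost on the machine is controlled through a small language of terms with bounded sums and
maxima. Terms are compiled to programs (`compile_exec`), recursive tables of terms are filled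
(`table_exec`), and `program_exec` adds up the costs. -/

namespace APEP

/-! ### Expressions with bounded sums and maxima -/

/-- The binary operations of the machine. -/
inductive BinOp
  | add
  | sub
  | mul
  | div

def BinOp.eval : BinOp → ℕ → ℕ → ℕ
  | add, x, y => x + y
  | sub, x, y => x - y
  | mul, x, y => x * y
  | div, x, y => x / y

def BinOp.expr : BinOp → Expr → Expr → Expr
  | add => Expr.add
  | sub => Expr.sub
  | mul => Expr.mul
  | div => Expr.div

/-- The two ways of accumulating values in a loop. -/
inductive AccOp
  | sum
  | sup

def AccOp.eval : AccOp → (ℕ → ℕ) → ℕ → ℕ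
  | sum, f, n => ∑ i ∈ Finset.range n, f i
  | sup, f, n => (Finset.range n).sup f

def AccOp.expr : AccOp → Expr → Expr → Expr
  | sum, x, y => .add x y
  -- With truncated subtraction, `x + (y - x)` is the maximum of `x` and `y`.
  | sup, x, y => .add x (.sub y x)

/-- Expressions over array entries and de Bruijn variables, with the operations of the machine and
with bounded sums and maxima. -/
inductive Term
  | lit (c : ℕ)
  | var (i : ℕ)
  | get (a : ℕ) (e : Term)
  | bin (o : BinOp) (e f : Term)
  | big (o : AccOp) (n e : Term)

namespace Term

/-- The value for the variables `ρ` and the arrays `M`. -/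
def eval (M : ℕ → ℕ → ℕ) : Term → List ℕ → ℕ
  | lit c, _ => c
  | var i, ρ => ρ.getD i 0
  | get a e, ρ => M a (e.eval M ρ)
  | bin o e f, ρ => o.eval (e.eval M ρ) (f.eval M ρ)
  | big o n e, ρ => o.eval (fun i => e.eval M (i :: ρ)) (n.eval M ρ)

/-- The number of elementary commands in an evaluation. -/
def steps (M : ℕ → ℕ → ℕ) : Term → List ℕ → ℕ
  | lit _, _ => 1
  | var _, _ => 1
  | get _ e, ρ => e.steps M ρ + 1
  | bin _ e f, ρ => e.steps M ρ + f.steps M ρ + 1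
  | big _ n e, ρ => n.steps M ρ + 3 + ∑ i ∈ Finset.range (n.eval M ρ), (e.steps M (i :: ρ) + 3)

/-- If all variables and array entries have at most `b` bits, then all numbers in an evaluation
have at most `e.weight * b` bits. -/
def weight : Term → ℕ
  | lit c => c.size + 1
  | var _ => 1
  | get _ e => e.weight + 1
  | bin _ e f => e.weight + f.weight + 1
  | big _ n e => n.weight + n.weight * e.weight

/-- The register of the variable of level `v`. -/
def varReg (v : ℕ) : ℕ := 2 * v + 1

/-- The `t`-th register for intermediate results. -/
def tmpReg (t : ℕ) : ℕ := 2 * t + 2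

/-- The loop `for x < lim do body; x := x + 1`, where `lim` and `x` are registers. -/
def forLoop (lim x : ℕ) (body : Program) : Program :=
  .loop (.sub (.var lim) (.var x)) (.seq body (.assign x (.add (.var x) (.lit 1))))

/-- A program that evaluates a term with `v` variables, using the registers for intermediate results
from the `t`-th on. -/
def compile : Term → ℕ → ℕ → Program
  | lit c, _, t => .assign (tmpReg t) (.lit c)
  -- Index `i` counts from the innermost binder, registers from the outermost; an index out of range
  -- yields `0`, as `getD` does in `eval`.
  | var i, v, t => .assign (tmpReg t) (if i < v then .var (varReg (v - 1 - i)) else .lit 0)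
  | get a e, v, t => .seq (e.compile v t) (.assign (tmpReg t) (.get a (.var (tmpReg t))))
  | bin o e f, v, t => .seq (e.compile v t) (.seq (f.compile v (t + 1))
      (.assign (tmpReg t) (o.expr (.var (tmpReg t)) (.var (tmpReg (t + 1))))))
  | big o n e, v, t => .seq (n.compile v (t + 1)) (.seq (.assign (tmpReg t) (.lit 0))
      (.seq (.assign (varReg v) (.lit 0)) (forLoop (tmpReg (t + 1)) (varReg v)
        (.seq (e.compile (v + 1) (t + 2))
          (.assign (tmpReg t) (o.expr (.var (tmpReg t)) (.var (tmpReg (t + 2)))))))))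

end Term

/-! ### Cost of elementary commands and of loops -/

/-- A bound for the cost of an elementary command on numbers with at most `B` bits. -/
def unitCost (B : ℕ) : ℕ := 10 * (B + 1) ^ 2

theorem unitCost_mono {B B' : ℕ} (h : B ≤ B') : unitCost B ≤ unitCost B' := by
  unfold unitCost; gcongr

theorem le_unitCost {c B : ℕ} (h : c ≤ 10 * B + 10) : c ≤ unitCost B := by
  unfold unitCost; nlinarith [Nat.zero_le (B * B)]

-- Besides its body, each round pays for the test and the increment, and the failing test at the end
-- pays once more. `hbody` gives the invariant for the state after the increment, which the loop
-- itself performs.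
open Term in
theorem exec_forLoop {lim x n B : ℕ} {body : Program} (Inv : ℕ → State → Prop) (cst : ℕ → ℕ)
    (hx : ∀ i σ, Inv i σ → σ.reg x = i ∧ σ.reg lim = n) (hn : n.size ≤ B)
    (hbody : ∀ i < n, ∀ σ, Inv i σ → ∃ c τ, Exec body σ c τ ∧ c ≤ cst i ∧ τ.reg x = i ∧
      Inv (i + 1) (τ.setReg x (i + 1))) (σ : State) (h0 : Inv 0 σ) :
    ∃ c τ, Exec (forLoop lim x body) σ c τ ∧
      c ≤ ∑ i ∈ Finset.range n, (cst i + 2 * unitCost B) + unitCost B ∧ Inv n τ := by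
  have hle : ∀ m ≤ n, m.size ≤ B := fun m hm => (Nat.size_le_size hm).trans hn
  suffices H : ∀ m i σ, i + m = n → Inv i σ → ∃ c τ, Exec (forLoop lim x body) σ c τ ∧
      c ≤ ∑ j ∈ Finset.range m, (cst (i + j) + 2 * unitCost B) + unitCost B ∧ Inv n τ by
    simpa using H n 0 σ (by simp) h0
  intro m
  induction m with
  | zero =>
    intro i σ hi hσ
    obtain ⟨h1, h2⟩ := hx i σ hσ
    have hin : i = n := by omega
    subst hin
    refine ⟨_, σ, Exec.loopFalse (by simp [Expr.eval, h1, h2]), ?_, hσ⟩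
    simp only [Expr.cost, Expr.eval, h1, h2, Finset.range_zero, Finset.sum_empty, zero_add]
    apply le_unitCost
    have : Nat.size (i - i) = 0 := by simp
    omega
  | succ m ih =>
    intro i σ hi hσ
    obtain ⟨h1, h2⟩ := hx i σ hσ
    obtain ⟨c, τ, hc, hcc, hτ, hI⟩ := hbody i (by omega) σ hσ
    obtain ⟨c', τ', hc', hcc', hI'⟩ := ih (i + 1) _ (by omega) hI
    have e1 : Exec (.assign x (.add (.var x) (.lit 1))) τ
        (1 + (Expr.add (.var x) (.lit 1)).cost τ) (τ.setReg x (i + 1)) := by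
      have := Exec.assign τ x (.add (.var x) (.lit 1))
      simpa only [Expr.eval, hτ] using this
    refine ⟨_, τ', Exec.loopTrue (by simp [Expr.eval, h1, h2]; omega) (Exec.seq hc e1) hc', ?_,
      hI'⟩
    rw [Finset.sum_range_succ']
    have hs : ∀ j, i + 1 + j = i + (j + 1) := by intros; omega
    simp only [hs] at hcc'
    have t1 : 1 + (Expr.sub (.var lim) (.var x)).cost σ ≤ unitCost B := by
      simp only [Expr.cost, Expr.eval, h1, h2]
      apply le_unitCost
      have := hle i (by omega)
      have := hle (n - i) (by omega)
      omega
    have t2 : 1 + (Expr.add (.var x) (.lit 1)).cost τ ≤ unitCost B := by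
      simp only [Expr.cost, Expr.eval, hτ]
      apply le_unitCost
      have := hle i (by omega)
      have := hle (i + 1) (by omega)
      have : Nat.size 1 = 1 := Nat.size_one
      omega
    simp only [add_zero]
    omega

/-! ### Bit lengths of values -/

namespace Term

theorem weight_pos (e : Term) : 1 ≤ e.weight := by
  induction e with
  | big o n e h h' => simp only [weight]; omega
  | _ => simp only [weight]; omega

/-- Induction over terms with `b` varying: under a bounded sum or maximum the new variable can be as
large as the bound, so the body is estimated with `n.weight * b` in place of `b`. This makes the
weights multiply. -/
theorem eval_lt (M : ℕ → ℕ → ℕ) (e : Term) : ∀ (ρ : List ℕ) (b : ℕ), 1 ≤ b →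
    (∀ i, ρ.getD i 0 < 2 ^ b) → (∀ a i, M a i < 2 ^ b) → e.eval M ρ < 2 ^ (e.weight * b) := by
  induction e with
  | lit c =>
    intro ρ b hb _ _
    have : c.size ≤ (c.size + 1) * b := by nlinarith
    exact (Nat.lt_size_self c).trans_le (Nat.pow_le_pow_right (by norm_num) this)
  | var i => intro ρ b hb h _; simpa [eval, weight] using h i
  | get a e ih =>
    intro ρ b hb _ h
    refine (h a _).trans_le (Nat.pow_le_pow_right (by norm_num) ?_)
    simp only [weight]; nlinarith [weight_pos e]
  | bin o e f ihe ihf =>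
    intro ρ b hb hρ h
    have h1 := ihe ρ b hb hρ h
    have h2 := ihf ρ b hb hρ h
    have h3 : (2 : ℕ) ^ (e.weight * b) * 2 ^ (f.weight * b) * 2 ≤
        2 ^ ((e.weight + f.weight + 1) * b) := by
      rw [← pow_add, ← pow_succ]
      apply Nat.pow_le_pow_right (by norm_num); nlinarith
    have p1 : 1 ≤ (2 : ℕ) ^ (e.weight * b) := Nat.one_le_two_pow
    have p2 : 1 ≤ (2 : ℕ) ^ (f.weight * b) := Nat.one_le_two_pow
    simp only [eval, weight]
    refine lt_of_lt_of_le ?_ h3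
    generalize (2 : ℕ) ^ (e.weight * b) = x at *
    generalize (2 : ℕ) ^ (f.weight * b) = y at *
    have q1 : x ≤ x * y := Nat.le_mul_of_pos_right _ p2
    have q2 : y ≤ x * y := Nat.le_mul_of_pos_left _ p1
    cases o with
    | add => simp only [BinOp.eval]; omega
    | sub => simp only [BinOp.eval]; omega
    | mul =>
      simp only [BinOp.eval]
      have := Nat.mul_le_mul h1.le h2.le
      have : 0 < x * y := by positivity
      omega
    | div =>
      simp only [BinOp.eval]
      have := Nat.div_le_self (e.eval M ρ) (f.eval M ρ)
      omega
  | big o n e ihn ihe =>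
    intro ρ b hb hρ h
    have h1 := ihn ρ b hb hρ h
    have hw := weight_pos n
    have hbb : b ≤ n.weight * b := Nat.le_mul_of_pos_left _ hw
    have hpow : (2 : ℕ) ^ b ≤ 2 ^ (n.weight * b) := Nat.pow_le_pow_right (by norm_num) hbb
    have h2 : ∀ i < n.eval M ρ, e.eval M (i :: ρ) < 2 ^ (e.weight * (n.weight * b)) := by
      intro i hi
      refine ihe (i :: ρ) (n.weight * b) (by omega) ?_ fun a j => (h a j).trans_le hpow
      intro j
      cases j with
      | zero => simp; omega
      | succ j => simpa using (hρ j).trans_le hpow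
    have h3 : (2 : ℕ) ^ (n.weight * b) * 2 ^ (e.weight * (n.weight * b)) =
        2 ^ ((n.weight + n.weight * e.weight) * b) := by
      rw [← pow_add]; ring_nf
    simp only [eval, weight, ← h3]
    set y := (2 : ℕ) ^ (e.weight * (n.weight * b))
    have hy : 0 < y := by positivity
    cases o with
    | sum =>
      have : ∑ i ∈ Finset.range (n.eval M ρ), e.eval M (i :: ρ) ≤ n.eval M ρ * y := by
        refine (Finset.sum_le_card_nsmul _ _ y ?_).trans (by simp)
        intro i hi; exact (h2 i (Finset.mem_range.1 hi)).le
      exact this.trans_lt (Nat.mul_lt_mul_of_pos_right h1 hy)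
    | sup =>
      have : (Finset.range (n.eval M ρ)).sup (fun i => e.eval M (i :: ρ)) < y := by
        rw [Finset.sup_lt_iff (by simpa using hy)]
        intro i hi; exact h2 i (Finset.mem_range.1 hi)
      exact this.trans_le (Nat.le_mul_of_pos_left _ (by positivity))

end Term

theorem AccOp.eval_succ_expr (o : AccOp) (f : ℕ → ℕ) (n x y : ℕ) (σ : State)
    (hx : σ.reg x = o.eval f n) (hy : σ.reg y = f n) :
    (o.expr (.var x) (.var y)).eval σ = o.eval f (n + 1) := by
  cases o with
  | sum => simp [AccOp.expr, AccOp.eval, Expr.eval, Finset.sum_range_succ] at *; omega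
  | sup =>
    simp only [AccOp.expr, AccOp.eval, Expr.eval, Finset.range_add_one, Finset.sup_insert] at *
    rw [hx, hy]
    rcases le_total (f n) ((Finset.range n).sup f) with h | h
    · rw [sup_eq_right.2 h]; omega
    · rw [sup_eq_left.2 h]; omega

theorem AccOp.eval_zero (o : AccOp) (f : ℕ → ℕ) : o.eval f 0 = 0 := by
  cases o <;> simp [AccOp.eval]

theorem AccOp.eval_mono (o : AccOp) (f : ℕ → ℕ) {m n : ℕ} (h : m ≤ n) :
    o.eval f m ≤ o.eval f n := by
  cases o with
  | sum => exact Finset.sum_le_sum_of_subset (Finset.range_mono h)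
  | sup => exact Finset.sup_mono (Finset.range_mono h)

theorem AccOp.le_eval (o : AccOp) (f : ℕ → ℕ) {i n : ℕ} (h : i < n) : f i ≤ o.eval f n := by
  cases o with
  | sum => exact Finset.single_le_sum (f := f) (fun _ _ => Nat.zero_le _) (Finset.mem_range.2 h)
  | sup => exact Finset.le_sup (f := f) (Finset.mem_range.2 h)

theorem AccOp.cost_expr_le (o : AccOp) (x y B : ℕ) (σ : State) (hx : (σ.reg x).size ≤ B)
    (hy : (σ.reg y).size ≤ B) (h : ((o.expr (.var x) (.var y)).eval σ).size ≤ B) :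
    1 + (o.expr (.var x) (.var y)).cost σ ≤ unitCost B := by
  apply le_unitCost
  cases o with
  | sum => simp only [AccOp.expr, Expr.cost, Expr.eval] at *; omega
  | sup =>
    simp only [AccOp.expr, Expr.cost, Expr.eval] at *
    have : (σ.reg y - σ.reg x).size ≤ (σ.reg y).size := Nat.size_le_size (Nat.sub_le _ _)
    omega

theorem BinOp.cost_expr_le (o : BinOp) (x y B : ℕ) (σ : State) (hx : (σ.reg x).size ≤ B)
    (hy : (σ.reg y).size ≤ B) (h : ((o.expr (.var x) (.var y)).eval σ).size ≤ B) :
    1 + (o.expr (.var x) (.var y)).cost σ ≤ unitCost B := by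
  have : (1 + (σ.reg x).size) * (1 + (σ.reg y).size) ≤ (1 + B) * (1 + B) := by gcongr
  unfold unitCost
  cases o <;> simp only [BinOp.expr, Expr.cost, Expr.eval] at * <;> nlinarith

theorem BinOp.eval_expr (o : BinOp) (e f : Expr) (σ : State) :
    (o.expr e f).eval σ = o.eval (e.eval σ) (f.eval σ) := by
  cases o <;> rfl

/-! ### Correctness and cost of compiled terms -/

namespace Term

/-- The registers hold the values of the variables. -/
def Holds (ρ : List ℕ) (σ : State) : Prop :=
  ∀ i < ρ.length, σ.reg (varReg (ρ.length - 1 - i)) = ρ.getD i 0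

/-- The state `τ` agrees with `σ` outside the registers available to an evaluation. -/
structure Agree (v t : ℕ) (σ τ : State) : Prop where
  arr : τ.arr = σ.arr
  zero : τ.reg 0 = σ.reg 0
  var : ∀ w < v, τ.reg (varReg w) = σ.reg (varReg w)
  tmp : ∀ s < t, τ.reg (tmpReg s) = σ.reg (tmpReg s)

theorem Agree.mono {v t v' t' : ℕ} {σ τ : State} (h : Agree v' t' σ τ) (hv : v ≤ v')
    (ht : t ≤ t') : Agree v t σ τ :=
  ⟨h.arr, h.zero, fun w hw => h.var w (by omega), fun w hw => h.tmp w (by omega)⟩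

theorem Agree.trans {v t : ℕ} {σ τ υ : State} (h : Agree v t σ τ) (h' : Agree v t τ υ) :
    Agree v t σ υ :=
  ⟨h'.arr.trans h.arr, h'.zero.trans h.zero,
    fun w hw => (h'.var w hw).trans (h.var w hw),
    fun w hw => (h'.tmp w hw).trans (h.tmp w hw)⟩

theorem Agree.setTmp (v t s c : ℕ) (σ : State) (h : t ≤ s) :
    Agree v t σ (σ.setReg (tmpReg s) c) := by
  refine ⟨rfl, ?_, fun w _ => ?_, fun w hw => ?_⟩ <;>
  · simp only [State.setReg, tmpReg, varReg]
    rw [Function.update_of_ne]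
    omega

theorem Agree.setVar (v t s c : ℕ) (σ : State) (h : v ≤ s) :
    Agree v t σ (σ.setReg (varReg s) c) := by
  refine ⟨rfl, ?_, fun w _ => ?_, fun w hw => ?_⟩ <;>
  · simp only [State.setReg, tmpReg, varReg]
    rw [Function.update_of_ne]
    omega

theorem Holds.agree {ρ : List ℕ} {t : ℕ} {σ τ : State} (h : Holds ρ σ)
    (h' : Agree ρ.length t σ τ) : Holds ρ τ :=
  fun i hi => (h'.var _ (by omega)).trans (h i hi)

theorem Holds.cons {ρ : List ℕ} {σ : State} (h : Holds ρ σ) {i : ℕ}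
    (hi : σ.reg (varReg ρ.length) = i) : Holds (i :: ρ) σ := by
  intro j hj
  cases j with
  | zero => simpa using hi
  | succ j =>
    have := h j (by simpa using hj)
    simp only [List.length_cons, List.getD_cons_succ] at *
    rw [← this]; congr 2; omega

theorem reg_setReg_self (σ : State) (x c : ℕ) : (σ.setReg x c).reg x = c := by
  simp [State.setReg]

theorem reg_setReg_of_ne (σ : State) {x y : ℕ} (c : ℕ) (h : y ≠ x) :
    (σ.setReg x c).reg y = σ.reg y := by
  simp [State.setReg, h]

/-- Variables live in odd registers and intermediate results in positive even ones; register `0` is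
never touched. A nested evaluation uses only later registers, so earlier results survive, which
`Agree` records. No array is written, so values and step counts always refer to the initial arrays.
-/
theorem compile_exec (e : Term) : ∀ (ρ : List ℕ) (t : ℕ) (σ : State) (b : ℕ), 1 ≤ b →
    (∀ i, ρ.getD i 0 < 2 ^ b) → (∀ a i, σ.arr a i < 2 ^ b) → Holds ρ σ →
    ∃ c τ, Exec (e.compile ρ.length t) σ c τ ∧ c ≤ e.steps σ.arr ρ * unitCost (e.weight * b) ∧
      Agree ρ.length t σ τ ∧ τ.reg (tmpReg t) = e.eval σ.arr ρ := by
  induction e with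
  | lit d =>
    intro ρ t σ b hb hρ hM hσ
    refine ⟨_, _, Exec.assign _ _ _, ?_, Agree.setTmp _ _ _ _ _ le_rfl, reg_setReg_self _ _ _⟩
    simp only [Expr.cost, steps, one_mul, weight]
    apply le_unitCost
    have : d.size ≤ (d.size + 1) * b := by nlinarith
    omega
  | var i =>
    intro ρ t σ b hb hρ hM hσ
    refine ⟨_, _, Exec.assign _ _ _, ?_, Agree.setTmp _ _ _ _ _ le_rfl, ?_⟩
    · simp only [steps, one_mul, weight]
      apply le_unitCost
      split_ifs with h
      · have := Nat.size_le.2 (hρ i)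
        simp only [Expr.cost, hσ i h]
        omega
      · simp [Expr.cost]
    · rw [reg_setReg_self]
      split_ifs with h
      · exact hσ i h
      · exact (List.getD_eq_default _ _ (not_lt.1 h)).symm
  | get a e ih =>
    intro ρ t σ b hb hρ hM hσ
    obtain ⟨c, τ, hc, hcc, hA, hv⟩ := ih ρ t σ b hb hρ hM hσ
    refine ⟨_, _, Exec.seq hc (Exec.assign _ _ _), ?_,
      hA.trans (Agree.setTmp _ _ _ _ _ le_rfl), ?_⟩
    · have h1 : c ≤ e.steps σ.arr ρ * unitCost ((get a e).weight * b) :=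
        hcc.trans (Nat.mul_le_mul_left _ (unitCost_mono (Nat.mul_le_mul_right _ (by simp [weight]))))
      have h2 : 1 + (Expr.get a (.var (tmpReg t))).cost τ ≤ unitCost ((get a e).weight * b) := by
        simp only [Expr.cost, Expr.eval, hv, hA.arr]
        apply le_unitCost
        have := Nat.size_le.2 (eval_lt σ.arr e ρ b hb hρ hM)
        have := Nat.size_le.2 (hM a (e.eval σ.arr ρ))
        simp only [weight, add_mul]
        omega
      simp only [steps, add_mul, one_mul]
      omega
    · rw [reg_setReg_self]
      simp only [Expr.eval, eval, hv, hA.arr]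
  | bin o e f ihe ihf =>
    intro ρ t σ b hb hρ hM hσ
    obtain ⟨c, τ, hc, hcc, hA, hv⟩ := ihe ρ t σ b hb hρ hM hσ
    obtain ⟨c', τ', hc', hcc', hA', hv'⟩ :=
      ihf ρ (t + 1) τ b hb hρ (by rw [hA.arr]; exact hM) (hσ.agree hA)
    rw [hA.arr] at hcc' hv'
    have hv2 : τ'.reg (tmpReg t) = e.eval σ.arr ρ := (hA'.tmp t (by omega)).trans hv
    have hval : (o.expr (.var (tmpReg t)) (.var (tmpReg (t + 1)))).eval τ' =
        (bin o e f).eval σ.arr ρ := by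
      simp only [BinOp.eval_expr, Expr.eval, hv2, hv', eval]
    refine ⟨_, _, Exec.seq hc (Exec.seq hc' (Exec.assign _ _ _)), ?_,
      (hA.trans (hA'.mono le_rfl (by omega))).trans (Agree.setTmp _ _ _ _ _ le_rfl), ?_⟩
    · have h1 : c ≤ e.steps σ.arr ρ * unitCost ((bin o e f).weight * b) :=
        hcc.trans (Nat.mul_le_mul_left _ (unitCost_mono (Nat.mul_le_mul_right _ (by
          simp only [weight]; omega))))
      have h2 : c' ≤ f.steps σ.arr ρ * unitCost ((bin o e f).weight * b) :=
        hcc'.trans (Nat.mul_le_mul_left _ (unitCost_mono (Nat.mul_le_mul_right _ (by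
          simp only [weight]; omega))))
      have h3 := o.cost_expr_le (tmpReg t) (tmpReg (t + 1)) ((bin o e f).weight * b) τ' (by
          rw [hv2]
          refine (Nat.size_le.2 (eval_lt σ.arr e ρ b hb hρ hM)).trans (Nat.mul_le_mul_right _ ?_)
          simp only [weight]; omega) (by
          rw [hv']
          refine (Nat.size_le.2 (eval_lt σ.arr f ρ b hb hρ hM)).trans (Nat.mul_le_mul_right _ ?_)
          simp only [weight]; omega) (by
          rw [hval]
          exact Nat.size_le.2 (eval_lt σ.arr _ ρ b hb hρ hM))
      simp only [steps, add_mul, one_mul]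
      omega
    · rw [reg_setReg_self, hval]
  | big o n e ihn ihe =>
    intro ρ t σ b hb hρ hM hσ
    obtain ⟨c, τ, hc, hcc, hA, hv⟩ := ihn ρ (t + 1) σ b hb hρ hM hσ
    set N := n.eval σ.arr ρ with hN
    set F := fun i => e.eval σ.arr (i :: ρ) with hF
    set B := (big o n e).weight * b with hB
    have hval : (big o n e).eval σ.arr ρ = o.eval F N := rfl
    have hbig := eval_lt σ.arr (big o n e) ρ b hb hρ hM
    rw [hval, ← hB] at hbig
    have hwn := weight_pos n
    have hwe := weight_pos e
    have hNlt := eval_lt σ.arr n ρ b hb hρ hM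
    have hnB : n.weight * b ≤ B := Nat.mul_le_mul_right _ (by simp only [weight]; omega)
    have hbn : b ≤ n.weight * b := Nat.le_mul_of_pos_left _ hwn
    have heB : e.weight * (n.weight * b) ≤ B := by
      simp only [hB, weight]; nlinarith [Nat.zero_le (n.weight * b)]
    have hNB : N.size ≤ B := (Nat.size_le.2 hNlt).trans hnB
    have hpow : (2 : ℕ) ^ b ≤ 2 ^ (n.weight * b) := Nat.pow_le_pow_right (by norm_num) hbn
    have hmono : ∀ {x y}, x ≤ y → (2 : ℕ) ^ x ≤ 2 ^ y := Nat.pow_le_pow_right (by norm_num)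
    set τ₁ := (τ.setReg (tmpReg t) 0).setReg (varReg ρ.length) 0 with hτ₁
    have hA₁ : Agree ρ.length t σ τ₁ :=
      ((hA.mono le_rfl (by omega)).trans (Agree.setTmp _ t _ _ _ le_rfl)).trans
        (Agree.setVar _ _ _ _ _ le_rfl)
    obtain ⟨c', τ', hc', hcc', hI, -, -, hv'⟩ := exec_forLoop (lim := tmpReg (t + 1))
      (x := varReg ρ.length) (n := N) (B := B)
      (body := .seq (e.compile (ρ.length + 1) (t + 2))
          (.assign (tmpReg t) (o.expr (.var (tmpReg t)) (.var (tmpReg (t + 2))))))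
      (fun i σ' => Agree ρ.length t σ σ' ∧ σ'.reg (varReg ρ.length) = i ∧
        σ'.reg (tmpReg (t + 1)) = N ∧ σ'.reg (tmpReg t) = o.eval F i)
      (fun i => (e.steps σ.arr (i :: ρ) + 1) * unitCost B)
      (fun i σ h => ⟨h.2.1, h.2.2.1⟩) hNB
      (by
        rintro i hi σ' ⟨hA', hx, hl, hacc⟩
        have hvars : ∀ j, (i :: ρ).getD j 0 < 2 ^ (n.weight * b) := by
          intro j
          cases j with
          | zero => simp; omega
          | succ j => simpa using (hρ j).trans_le hpow
        obtain ⟨c₁, τ₂, h₁, hc₁, hA₂, hv₂⟩ := ihe (i :: ρ) (t + 2) σ' (n.weight * b) (by omega)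
          hvars (fun a j => by rw [hA'.arr]; exact (hM a j).trans_le hpow)
          ((hσ.agree hA').cons hx)
        rw [hA'.arr] at hc₁ hv₂
        have ht : τ₂.reg (tmpReg t) = o.eval F i := (hA₂.tmp t (by omega)).trans hacc
        have hval := o.eval_succ_expr F i (tmpReg t) (tmpReg (t + 2)) τ₂ ht hv₂
        refine ⟨_, _, Exec.seq h₁ (Exec.assign _ _ _), ?_, ?_, ?_, ?_, ?_, ?_⟩
        · have := o.cost_expr_le (tmpReg t) (tmpReg (t + 2)) B τ₂
            (by
              rw [ht]
              exact Nat.size_le.2 ((o.eval_mono F hi.le).trans_lt hbig))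
            (by
              rw [hv₂]
              exact Nat.size_le.2 ((o.le_eval F hi).trans_lt hbig))
            (by
              rw [hval]
              exact Nat.size_le.2 ((o.eval_mono F hi).trans_lt hbig))
          have := hc₁.trans (Nat.mul_le_mul_left _ (unitCost_mono heB))
          simp only [add_mul, one_mul]
          omega
        · rw [reg_setReg_of_ne _ _ (by simp only [varReg, tmpReg]; omega)]
          exact (hA₂.var _ (by simp)).trans hx
        · exact ((hA'.trans (hA₂.mono (by simp) (by omega))).trans
            (Agree.setTmp _ _ _ _ _ le_rfl)).trans (Agree.setVar _ _ _ _ _ le_rfl)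
        · exact reg_setReg_self _ _ _
        · rw [reg_setReg_of_ne _ _ (by simp only [varReg, tmpReg]; omega),
            reg_setReg_of_ne _ _ (by simp only [tmpReg]; omega)]
          exact (hA₂.tmp _ (by omega)).trans hl
        · rw [reg_setReg_of_ne _ _ (by simp only [varReg, tmpReg]; omega), reg_setReg_self, hval])
      τ₁ ⟨hA₁, reg_setReg_self _ _ _, by
        rw [hτ₁, reg_setReg_of_ne _ _ (by simp only [varReg, tmpReg]; omega),
          reg_setReg_of_ne _ _ (by simp only [tmpReg]; omega), hv], by
        rw [hτ₁, reg_setReg_of_ne _ _ (by simp only [varReg, tmpReg]; omega), reg_setReg_self,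
          o.eval_zero]⟩
    refine ⟨_, τ', Exec.seq hc (Exec.seq (Exec.assign _ _ _) (Exec.seq (Exec.assign _ _ _) hc')),
      ?_, hI, hv'⟩
    have h1 : ∀ σ', 1 + (Expr.lit 0).cost σ' ≤ unitCost B := fun σ' => by
      apply le_unitCost
      simp only [Expr.cost, Nat.size_zero]
      omega
    have h2 : ∑ i ∈ Finset.range N, ((e.steps σ.arr (i :: ρ) + 1) * unitCost B + 2 * unitCost B) =
        (∑ i ∈ Finset.range N, (e.steps σ.arr (i :: ρ) + 3)) * unitCost B := by
      rw [Finset.sum_mul]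
      exact Finset.sum_congr rfl fun i _ => by ring
    have h3 := hcc.trans (Nat.mul_le_mul_left _ (unitCost_mono hnB))
    have h4 := h1 τ
    have h5 := h1 (τ.setReg (tmpReg t) (Expr.eval τ (.lit 0)))
    rw [h2] at hcc'
    simp only [steps, add_mul, ← hN]
    omega

/-! ### Tables filled entry by entry -/

/-- The program that sets the `i`-th entry of the array `a` to the value of `e` at `i`, for
`i = 0, 1, …` below the value of `len`. -/
def table (a : ℕ) (len e : Term) : Program :=
  .seq (len.compile 0 0) (.seq (.assign (varReg 0) (.lit 0))
    (forLoop (tmpReg 0) (varReg 0)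
      (.seq (e.compile 1 1) (.store a (.var (varReg 0)) (.var (tmpReg 1))))))

/-- The arrays `M` with the first `n` entries of the array `a` given by `f`. -/
def fill (M : ℕ → ℕ → ℕ) (a : ℕ) (f : ℕ → ℕ) (n : ℕ) : ℕ → ℕ → ℕ :=
  Function.update M a fun i => if i < n then f i else M a i

theorem fill_self (M : ℕ → ℕ → ℕ) (a : ℕ) (f : ℕ → ℕ) (n i : ℕ) :
    fill M a f n a i = if i < n then f i else M a i := by
  simp [fill]

theorem fill_of_ne (M : ℕ → ℕ → ℕ) {a a' : ℕ} (f : ℕ → ℕ) (n : ℕ) (h : a' ≠ a) :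
    fill M a f n a' = M a' := by
  simp [fill, h]

theorem fill_zero (M : ℕ → ℕ → ℕ) (a : ℕ) (f : ℕ → ℕ) : fill M a f 0 = M := by
  simp [fill]

theorem fill_succ (M : ℕ → ℕ → ℕ) (a : ℕ) (f : ℕ → ℕ) (n : ℕ) :
    Function.update (fill M a f n) a (Function.update (fill M a f n a) n (f n)) =
      fill M a f (n + 1) := by
  unfold fill
  rw [Function.update_idem]
  congr 1
  funext i
  by_cases h : i = n
  · simp [h]
  · have : i < n + 1 ↔ i < n := by omega
    simp [h, this]

theorem fill_lt {M : ℕ → ℕ → ℕ} {a : ℕ} {f : ℕ → ℕ} {n m : ℕ} (hM : ∀ a i, M a i < m)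
    (hf : ∀ i < n, f i < m) (a' i : ℕ) : fill M a f n a' i < m := by
  by_cases h : a' = a
  · subst h
    rw [fill_self]
    split_ifs with h
    exacts [hf i h, hM _ _]
  · rw [fill_of_ne _ _ _ h]; exact hM _ _

/-- In `he`, entry `i` is evaluated when the entries below `i` are already in place, so recursive
tables are allowed. The weight of the sum of `e` up to `len` is the right measure, because the index
of the loop runs up to the value of `len`. -/
theorem table_exec {a : ℕ} {len e : Term} {σ : State} {b n s W : ℕ} (f : ℕ → ℕ) (hb : 1 ≤ b)
    (hM : ∀ a i, σ.arr a i < 2 ^ b) (hn : len.eval σ.arr [] = n)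
    (hW : (big .sum len e).weight ≤ W) (hf : ∀ i < n, f i < 2 ^ b)
    (he : ∀ i < n, e.eval (fill σ.arr a f i) [i] = f i)
    (hs : ∀ i < n, e.steps (fill σ.arr a f i) [i] ≤ s) :
    ∃ c τ, Exec (table a len e) σ c τ ∧
      c ≤ (len.steps σ.arr [] + 2 + n * (s + 3)) * unitCost (W * b) ∧
      τ.reg 0 = σ.reg 0 ∧ τ.arr = fill σ.arr a f n := by
  obtain ⟨c, τ, hc, hcc, hA, hv⟩ := compile_exec len [] 0 σ b hb (by simp) hM
    (by intro i hi; simp at hi)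
  rw [hn] at hv
  have hwn := weight_pos len
  have hwe := weight_pos e
  simp only [weight] at hW
  have hnlt : n < 2 ^ (len.weight * b) := hn ▸ eval_lt σ.arr len [] b hb (by simp) hM
  set B := W * b with hB
  have hnB : len.weight * b ≤ B := Nat.mul_le_mul_right _ (by omega)
  have hbn : b ≤ len.weight * b := Nat.le_mul_of_pos_left _ hwn
  have heB : e.weight * (len.weight * b) ≤ B := by
    have := Nat.mul_le_mul_right b hW
    nlinarith [Nat.zero_le (len.weight * b)]
  have hpow : (2 : ℕ) ^ b ≤ 2 ^ (len.weight * b) := Nat.pow_le_pow_right (by norm_num) hbn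
  have hNB : n.size ≤ B := (Nat.size_le.2 hnlt).trans hnB
  obtain ⟨c', τ', hc', hcc', hI, hz, -⟩ := exec_forLoop (lim := tmpReg 0)
    (x := varReg 0) (n := n) (B := B)
    (body := .seq (e.compile 1 1) (.store a (.var (varReg 0)) (.var (tmpReg 1))))
    (fun i σ' => σ'.arr = fill σ.arr a f i ∧ σ'.reg 0 = σ.reg 0 ∧ σ'.reg (varReg 0) = i ∧
      σ'.reg (tmpReg 0) = n)
    (fun _ => (s + 1) * unitCost B) (fun i σ h => ⟨h.2.2.1, h.2.2.2⟩) hNB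
    (by
      rintro i hi σ' ⟨harr, hz, hx, hl⟩
      have hvars : ∀ j, [i].getD j 0 < 2 ^ (len.weight * b) := by
        intro j
        cases j with
        | zero => simp; omega
        | succ j => simp
      have hM' : ∀ a' j, σ'.arr a' j < 2 ^ (len.weight * b) := by
        rw [harr]
        exact fill_lt (fun a j => (hM a j).trans_le hpow)
          (fun j hj => (hf j (hj.trans hi)).trans_le hpow)
      obtain ⟨c₁, τ₂, h₁, hc₁, hA₂, hv₂⟩ := compile_exec e [i] 1 σ' (len.weight * b) (by omega)
        hvars hM' (Holds.cons (ρ := []) (by intro i hi; simp at hi) hx)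
      rw [harr, he i hi] at hv₂
      have hx₂ : τ₂.reg (varReg 0) = i := (hA₂.var 0 (by simp)).trans hx
      refine ⟨_, _, Exec.seq h₁ (Exec.store _ _ _ _), ?_, hx₂, ?_, ?_, ?_, ?_⟩
      · have h1 : c₁ ≤ s * unitCost B :=
          hc₁.trans (Nat.mul_le_mul (harr ▸ hs i hi) (unitCost_mono heB))
        have h2 : 1 + (Expr.var (varReg 0)).cost τ₂ + (Expr.var (tmpReg 1)).cost τ₂ ≤
            unitCost B := by
          apply le_unitCost
          simp only [Expr.cost, hx₂, hv₂]
          have := (Nat.size_le_size hi.le).trans hNB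
          have := (Nat.size_le.2 (hf i hi)).trans (hbn.trans hnB)
          omega
        simp only [add_mul, one_mul]
        omega
      · simp only [State.setArr, State.setReg, Expr.eval, hx₂, hv₂, hA₂.arr, harr, fill_succ]
      · rw [reg_setReg_of_ne _ _ (by simp only [varReg]; omega)]
        exact hA₂.zero.trans hz
      · exact reg_setReg_self _ _ _
      · rw [reg_setReg_of_ne _ _ (by simp only [varReg, tmpReg]; omega)]
        exact (hA₂.tmp 0 (by simp)).trans hl)
    (τ.setReg (varReg 0) 0) ⟨by rw [fill_zero]; exact hA.arr, by
      rw [reg_setReg_of_ne _ _ (by simp only [varReg]; omega), hA.zero], reg_setReg_self _ _ _, by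
      rw [reg_setReg_of_ne _ _ (by simp only [varReg, tmpReg]; omega), hv]⟩
  refine ⟨_, τ', Exec.seq hc (Exec.seq (Exec.assign _ _ _) hc'), ?_, hz, hI⟩
  have h1 : 1 + (Expr.lit 0).cost τ ≤ unitCost B := by
    apply le_unitCost
    simp only [Expr.cost, Nat.size_zero]
    omega
  have h3 := hcc.trans (Nat.mul_le_mul_left _ (unitCost_mono hnB))
  rw [Finset.sum_const, Finset.card_range, smul_eq_mul] at hcc'
  have h4 : n * ((s + 1) * unitCost B + 2 * unitCost B) = n * (s + 3) * unitCost B := by ring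
  simp only [add_mul]
  omega

end Term
/-! ### Bit masks -/

/-- The `r`-th binary digit. -/
def bit (x r : ℕ) : ℕ := (x.testBit r).toNat

/-- The remainder modulo `2` in terms of the operations of the machine, given a table of powers of
two. -/
theorem bit_eq (x r : ℕ) : bit x r = x / 2 ^ r - x / 2 ^ r / 2 * 2 := by
  rw [bit, Nat.toNat_testBit]; omega

theorem bit_le_one (x r : ℕ) : bit x r ≤ 1 := Bool.toNat_le _

theorem sum_two_pow_mul_lt (b : ℕ → ℕ) (hb : ∀ r, b r ≤ 1) (k : ℕ) :
    ∑ r ∈ Finset.range k, 2 ^ r * b r < 2 ^ k := by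
  induction k with
  | zero => simp
  | succ k ih =>
    rw [Finset.sum_range_succ, pow_succ]
    have := Nat.mul_le_mul_left (2 ^ k) (hb k)
    omega

theorem testBit_sum_two_pow_mul (b : ℕ → ℕ) (hb : ∀ r, b r ≤ 1) (k i : ℕ) :
    (∑ r ∈ Finset.range k, 2 ^ r * b r).testBit i = decide (i < k ∧ b i = 1) := by
  induction k with
  | zero => simp
  | succ k ih =>
    rw [Finset.sum_range_succ, add_comm,
      Nat.testBit_two_pow_mul_add _ (sum_two_pow_mul_lt b hb k)]
    split_ifs with h
    · rw [ih]; congr 1; simp [h]; omega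
    · by_cases hi : i = k
      · subst hi
        have := hb i
        interval_cases b i <;> simp
      · have : i - k ≠ 0 := by omega
        have h2 : ¬ i < k + 1 := by omega
        have := hb k
        simp only [h2, false_and, decide_false]
        rw [Nat.testBit_lt_two_pow]
        exact this.trans_lt (Nat.one_lt_two_pow ‹_›)

/-- The mask of the elements of the mask `S` below `k` that are not in the mask `X`. -/
def diff (k S X : ℕ) : ℕ := ∑ r ∈ Finset.range k, 2 ^ r * (bit S r * (1 - bit X r))

theorem bit_mul_le_one (S X r : ℕ) : bit S r * (1 - bit X r) ≤ 1 :=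
  (Nat.mul_le_mul (bit_le_one _ _) (Nat.sub_le _ _)).trans (by norm_num)

theorem diff_lt (k S X : ℕ) : diff k S X < 2 ^ k := sum_two_pow_mul_lt _ (bit_mul_le_one S X) k

theorem testBit_diff (k S X i : ℕ) :
    (diff k S X).testBit i = (decide (i < k) && (S.testBit i && !X.testBit i)) := by
  rw [diff, testBit_sum_two_pow_mul _ (bit_mul_le_one S X)]
  simp only [bit]
  by_cases h : S.testBit i = true <;> by_cases h' : X.testBit i = true <;> simp [h, h']

theorem sum_two_pow_mul_lt' (T : ℕ → ℕ) (k n : ℕ) (hT : ∀ j < n, T j < 2 ^ k) :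
    ∑ j ∈ Finset.range n, 2 ^ (j * k) * T j < 2 ^ (n * k) := by
  induction n with
  | zero => simp
  | succ n ih =>
    rw [Finset.sum_range_succ, add_mul, one_mul, pow_add]
    have h1 := ih fun j hj => hT j (by omega)
    have h2 := Nat.mul_le_mul_left (2 ^ (n * k)) (Nat.succ_le_of_lt (hT n (by omega)))
    rw [Nat.mul_succ] at h2
    omega

/-- The masks are the digits in base `2 ^ k`. Hence the binary digits of the sum list the matrix row
by row, in the order of `encodeMatrix`. -/
theorem testBit_sum_two_pow_mul' (T : ℕ → ℕ) (k n : ℕ) (hT : ∀ j < n, T j < 2 ^ k) (j r : ℕ)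
    (hj : j < n) (hr : r < k) :
    (∑ j ∈ Finset.range n, 2 ^ (j * k) * T j).testBit (j * k + r) = (T j).testBit r := by
  induction n with
  | zero => omega
  | succ n ih =>
    have hT' : ∀ j < n, T j < 2 ^ k := fun j hj => hT j (by omega)
    rw [Finset.sum_range_succ, add_comm,
      Nat.testBit_two_pow_mul_add _ (sum_two_pow_mul_lt' T k n hT')]
    by_cases h : j < n
    · have : j * k + r < n * k := by nlinarith
      rw [if_pos this, ih hT' h]
    · have : j = n := by omega
      subst this
      simp

/-! ### The dynamic program -/

theorem exists_eq_sup {f : ℕ → ℕ} {n : ℕ} (h : (Finset.range n).sup f ≠ 0) :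
    ∃ i < n, f i = (Finset.range n).sup f := by
  have hn : (Finset.range n).Nonempty := by
    rw [Finset.nonempty_iff_ne_empty]
    intro h'
    simp [h'] at h
  obtain ⟨i, hi, h⟩ := Finset.exists_mem_eq_sup _ hn f
  exact ⟨i, Finset.mem_range.1 hi, h.symm⟩

section DP

variable (n k L : ℕ) (base con : ℕ → ℕ → ℕ) (cm : ℕ → ℕ)

/-- This is `0` if the mask `T` is a possible set of resources for the user `j` and contains the
mask `X`. -/
def defect (j X T : ℕ) : ℕ :=
  (∑ r ∈ Finset.range k, ∑ r' ∈ Finset.range k, con r r' * (bit T r * bit T r')) +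
    (∑ r ∈ Finset.range k, bit T r * (1 - base j r)) +
    ∑ r ∈ Finset.range k, bit X r * (1 - bit T r)

theorem defect_eq_zero (j X T : ℕ) : defect k base con j X T = 0 ↔
    (∀ r < k, ∀ r' < k, con r r' ≠ 0 → T.testBit r → T.testBit r' → False) ∧
    (∀ r < k, T.testBit r → base j r ≠ 0) ∧ ∀ r < k, X.testBit r → T.testBit r := by
  simp only [defect, Nat.add_eq_zero_iff, Finset.sum_eq_zero_iff, Finset.mem_range, and_assoc]
  refine and_congr ?_ (and_congr ?_ ?_)
  · refine forall₂_congr fun r _ => forall₂_congr fun r' _ => ?_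
    simp only [bit]
    cases T.testBit r <;> cases T.testBit r' <;> simp
  · refine forall₂_congr fun r _ => ?_
    simp only [bit]
    cases T.testBit r <;> simp [Nat.sub_eq_zero_iff_le, Nat.one_le_iff_ne_zero]
  · refine forall₂_congr fun r _ => ?_
    simp only [bit]
    cases T.testBit r <;> cases X.testBit r <;> simp

/-- The number of elements of the mask `T`. -/
def pop (T : ℕ) : ℕ := ∑ r ∈ Finset.range k, bit T r

/-- The contribution of the user `j` with the mask `T`: its leading digits count, and the other
digits describe the mask. -/
def weightOf (j T : ℕ) : ℕ := (pop k T + 1) * 2 ^ (n * k) + 2 ^ (j * k) * T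

/-- The best contribution of the user `j` with a mask containing `cm l`. -/
def gain (j l : ℕ) : ℕ :=
  (Finset.range (2 ^ k)).sup fun T => (1 - defect k base con j (cm l) T) * weightOf n k j T

/-- The best total contribution of the first `j` users with masks that cover `S`; it is `0` if there
are none. -/
def best : ℕ → ℕ → ℕ
  | 0, S => (1 - S) * 2 ^ (n * k)
  | j + 1, S => (Finset.range L).sup fun l =>
      (1 - (1 - best j (diff k S (cm l)))) * (1 - (1 - gain n k base con cm j l)) *
        (best j (diff k S (cm l)) + gain n k base con cm j l)

/-- The masks `T` and the cover masks `cm (l j)` form a possible choice for the first `m` users. -/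
def Feasible (m : ℕ) (T l : ℕ → ℕ) : Prop :=
  ∀ j < m, l j < L ∧ T j < 2 ^ k ∧ defect k base con j (cm (l j)) (T j) = 0

def total (m : ℕ) (T : ℕ → ℕ) : ℕ := 2 ^ (n * k) + ∑ j ∈ Finset.range m, weightOf n k j (T j)

variable {n k L base con cm}

theorem weightOf_pos (j T : ℕ) : 0 < weightOf n k j T := by
  unfold weightOf; positivity

theorem eq_zero_of_testBit {S : ℕ} (hS : S < 2 ^ k) (h : ∀ r < k, S.testBit r = false) : S = 0 := by
  apply Nat.eq_of_testBit_eq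
  intro i
  rw [Nat.zero_testBit]
  by_cases hi : i < k
  · exact h i hi
  · exact Nat.testBit_lt_two_pow (hS.trans_le (Nat.pow_le_pow_right (by norm_num) (not_lt.1 hi)))

/-- Removing the last user leaves a feasible choice, whose masks cover whatever the last cover mask
misses of `S`. Both contributions are positive, so the sign factors in `best` do not suppress them.
-/
theorem total_le_best {m : ℕ} {T l : ℕ → ℕ} (h : Feasible k L base con cm m T l) :
    ∀ {S : ℕ}, S < 2 ^ k → (∀ r < k, S.testBit r → ∃ j < m, (cm (l j)).testBit r) →
    total n k m T ≤ best n k L base con cm m S := by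
  induction m with
  | zero =>
    intro S hS hc
    have : S = 0 := eq_zero_of_testBit hS fun r hr => by simpa using hc r hr
    simp [this, total, best]
  | succ m ih =>
    intro S hS hc
    have h1 := ih (fun j hj => h j (by omega)) (diff_lt k S (cm (l m))) (by
      intro r hr h'
      simp only [testBit_diff, hr, decide_true, Bool.true_and, Bool.and_eq_true,
        Bool.not_eq_true'] at h'
      obtain ⟨j, hj, h''⟩ := hc r hr h'.1
      refine ⟨j, ?_, h''⟩
      rcases Nat.lt_succ_iff_lt_or_eq.1 hj with hj | rfl
      · exact hj
      · simp [h''] at h')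
    obtain ⟨hl, hT, hd⟩ := h m (by omega)
    have h2 : weightOf n k m (T m) ≤ gain n k base con cm m (l m) := by
      have := Finset.le_sup (f := fun T => (1 - defect k base con m (cm (l m)) T) *
        weightOf n k m T) (Finset.mem_range.2 hT)
      simp only [hd, Nat.sub_zero, one_mul] at this
      exact this
    have h3 : 0 < total n k m T := by unfold total; positivity
    have h4 := weightOf_pos (n := n) (k := k) m (T m)
    have h5 : total n k (m + 1) T = total n k m T + weightOf n k m (T m) := by
      simp [total, Finset.sum_range_succ, add_assoc]
    rw [best]
    refine le_trans ?_ (Finset.le_sup (Finset.mem_range.2 hl))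
    rw [show 1 - best n k L base con cm m (diff k S (cm (l m))) = 0 by omega,
      show 1 - gain n k base con cm m (l m) = 0 by omega]
    omega

theorem exists_of_gain_ne_zero {j l : ℕ} (h : gain n k base con cm j l ≠ 0) :
    ∃ T < 2 ^ k, defect k base con j (cm l) T = 0 ∧ gain n k base con cm j l = weightOf n k j T := by
  obtain ⟨T, hT, h'⟩ := exists_eq_sup h
  have h0 : defect k base con j (cm l) T = 0 := by
    by_contra h0
    rw [show 1 - defect k base con j (cm l) T = 0 by omega, zero_mul] at h'
    exact h h'.symm
  refine ⟨T, hT, h0, ?_⟩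
  rw [h0, Nat.sub_zero, one_mul] at h'
  exact h'.symm

/-- A nonzero maximum is attained at some cover mask, and there both sign factors are nonzero. The
induction hypothesis thus supplies the earlier users and `gain` the row of the last one. -/
theorem exists_of_best_ne_zero {m : ℕ} : ∀ {S : ℕ}, S < 2 ^ k →
    best n k L base con cm m S ≠ 0 → ∃ T l, Feasible k L base con cm m T l ∧
      (∀ r < k, S.testBit r → ∃ j < m, (cm (l j)).testBit r) ∧
      best n k L base con cm m S = total n k m T := by
  induction m with
  | zero =>
    intro S hS h
    have : S = 0 := by
      by_contra h0
      apply h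
      rw [best, show 1 - S = 0 by omega, zero_mul]
    subst this
    exact ⟨fun _ => 0, fun _ => 0, fun j hj => by omega, by simp, by simp [best, total]⟩
  | succ m ih =>
    intro S hS h
    rw [best] at h ⊢
    obtain ⟨i, hi, h'⟩ := exists_eq_sup h
    rw [← h'] at h ⊢
    clear h'
    have h1 : best n k L base con cm m (diff k S (cm i)) ≠ 0 := by
      intro h0; simp [h0] at h
    have h2 : gain n k base con cm m i ≠ 0 := by
      intro h0; simp [h0] at h
    obtain ⟨T₀, hT₀, hd, hg⟩ := exists_of_gain_ne_zero h2
    obtain ⟨T, l, hF, hc, hb⟩ := ih (diff_lt k S (cm i)) h1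
    refine ⟨Function.update T m T₀, Function.update l m i, ?_, ?_, ?_⟩
    · intro j hj
      by_cases h : j = m
      · subst h; simp [hi, hT₀, hd]
      · simpa [h] using hF j (by omega)
    · intro r hr hS
      by_cases hri : (cm i).testBit r
      · exact ⟨m, by omega, by simpa using hri⟩
      · obtain ⟨j, hj, h⟩ := hc r hr (by simp [testBit_diff, hr, hS, hri])
        exact ⟨j, by omega, by simpa [hj.ne] using h⟩
    · have hs : ∑ j ∈ Finset.range m, weightOf n k j (Function.update T m T₀ j) =
          ∑ j ∈ Finset.range m, weightOf n k j (T j) :=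
        Finset.sum_congr rfl fun j hj => by
          rw [Function.update_of_ne (Finset.mem_range.1 hj).ne]
      rw [show 1 - best n k L base con cm m (diff k S (cm i)) = 0 by omega,
        show 1 - gain n k base con cm m i = 0 by omega, hb, hg]
      simp only [total, Finset.sum_range_succ, hs, Function.update_self]
      omega

theorem pop_le (T : ℕ) : pop k T ≤ k :=
  (Finset.sum_le_card_nsmul _ _ 1 fun r _ => bit_le_one T r).trans (by simp)

theorem gain_le {j : ℕ} (hj : j < n) (l : ℕ) : gain n k base con cm j l ≤ 2 ^ (n * k + k + 1) := by
  refine Finset.sup_le fun T hT => ?_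
  have h1 : (1 - defect k base con j (cm l) T) * weightOf n k j T ≤ weightOf n k j T :=
    (Nat.mul_le_mul_right _ (Nat.sub_le _ _)).trans (by simp)
  refine h1.trans ?_
  have h2 : pop k T + 1 ≤ 2 ^ k := Nat.succ_le_of_lt ((pop_le T).trans_lt k.lt_two_pow_self)
  have h3 : (2 : ℕ) ^ (j * k) ≤ 2 ^ (n * k) :=
    Nat.pow_le_pow_right (by norm_num) (Nat.mul_le_mul_right _ hj.le)
  have h4 : (pop k T + 1) * 2 ^ (n * k) ≤ 2 ^ k * 2 ^ (n * k) := Nat.mul_le_mul_right _ h2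
  have h5 : 2 ^ (j * k) * T ≤ 2 ^ (n * k) * 2 ^ k := Nat.mul_le_mul h3 (Finset.mem_range.1 hT).le
  rw [weightOf, pow_succ, pow_add]
  linarith

theorem best_le {m : ℕ} : ∀ S : ℕ, m ≤ n →
    best n k L base con cm m S ≤ (m + 1) * 2 ^ (n * k + k + 1) := by
  induction m with
  | zero =>
    intro S _
    rw [best]
    refine Nat.mul_le_mul (by omega) (Nat.pow_le_pow_right (by norm_num) (by omega))
  | succ m ih =>
    intro S hm
    rw [best]
    refine Finset.sup_le fun l _ => ?_
    have h1 := ih (diff k S (cm l)) (by omega)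
    have h2 := gain_le (n := n) (k := k) (base := base) (con := con) (cm := cm)
      (show m < n by omega) l
    have h3 : (1 - (1 - best n k L base con cm m (diff k S (cm l)))) *
        (1 - (1 - gain n k base con cm m l)) ≤ 1 :=
      (Nat.mul_le_mul (Nat.sub_le _ _) (Nat.sub_le _ _)).trans (by norm_num)
    refine (Nat.mul_le_mul_right _ h3).trans ?_
    rw [add_mul (m + 1)]
    omega

/-- Although whole relations are packed into single numbers, the bit length is polynomial in `n` and
`k`; so is the cost of each elementary command. -/
theorem best_lt {m : ℕ} (S : ℕ) (hm : m ≤ n) :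
    best n k L base con cm m S < 2 ^ (n * k + k + n + 2) := by
  refine (best_le S hm).trans_lt ?_
  have h1 : m + 1 < 2 ^ (n + 1) := lt_of_le_of_lt (by omega) (n + 1).lt_two_pow_self
  rw [show n * k + k + n + 2 = (n + 1) + (n * k + k + 1) by ring, pow_add 2 (n + 1)]
  exact Nat.mul_lt_mul_of_pos_right h1 (Nat.two_pow_pos _)

end DP
/-! ### The program -/

namespace Term

instance : Add Term := ⟨bin .add⟩
instance : Sub Term := ⟨bin .sub⟩
instance : Mul Term := ⟨bin .mul⟩
instance : Div Term := ⟨bin .div⟩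

variable (M : ℕ → ℕ → ℕ) (e f : Term) (ρ : List ℕ)

theorem eval_lit (c : ℕ) : (lit c).eval M ρ = c := rfl
theorem eval_var_zero (i : ℕ) : (var 0).eval M (i :: ρ) = i := rfl
theorem eval_var_one (i j : ℕ) : (var 1).eval M (i :: j :: ρ) = j := rfl
theorem eval_var_two (i j l : ℕ) : (var 2).eval M (i :: j :: l :: ρ) = l := rfl
theorem eval_get (a : ℕ) : (get a e).eval M ρ = M a (e.eval M ρ) := rfl
theorem eval_add : (e + f).eval M ρ = e.eval M ρ + f.eval M ρ := rfl
theorem eval_sub : (e - f).eval M ρ = e.eval M ρ - f.eval M ρ := rfl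
theorem eval_mul : (e * f).eval M ρ = e.eval M ρ * f.eval M ρ := rfl
theorem eval_div : (e / f).eval M ρ = e.eval M ρ / f.eval M ρ := rfl
theorem eval_sum : (big .sum e f).eval M ρ =
  ∑ i ∈ Finset.range (e.eval M ρ), f.eval M (i :: ρ) := rfl
theorem eval_sup : (big .sup e f).eval M ρ =
  (Finset.range (e.eval M ρ)).sup fun i => f.eval M (i :: ρ) := rfl
theorem steps_lit (c : ℕ) : (lit c).steps M ρ = 1 := rfl
theorem steps_var (i : ℕ) : (var i).steps M ρ = 1 := rfl
theorem steps_get (a : ℕ) : (get a e).steps M ρ = e.steps M ρ + 1 := rfl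
theorem steps_add : (e + f).steps M ρ = e.steps M ρ + f.steps M ρ + 1 := rfl
theorem steps_sub : (e - f).steps M ρ = e.steps M ρ + f.steps M ρ + 1 := rfl
theorem steps_mul : (e * f).steps M ρ = e.steps M ρ + f.steps M ρ + 1 := rfl
theorem steps_div : (e / f).steps M ρ = e.steps M ρ + f.steps M ρ + 1 := rfl
theorem steps_big (o : AccOp) : (big o e f).steps M ρ =
  e.steps M ρ + 3 + ∑ i ∈ Finset.range (e.eval M ρ), (f.steps M (i :: ρ) + 3) := rfl

/-- The number of users. -/
def users : Term := get 0 (lit 0)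

/-- The number of resources. -/
def resources : Term := get 0 (lit 1)

/-- The power of two with the exponent `e`. -/
def pow (e : Term) : Term := get 1 e

/-- The remainder of `e` modulo `f`. -/
def mod (e f : Term) : Term := e - e / f * f

/-- The digit number `r` of `x`. -/
def digit (x r : Term) : Term := mod (x / pow r) (lit 2)

/-- `1` if `e` is not `0`. -/
def sign (e : Term) : Term := lit 1 - (lit 1 - e)

/-- The entries of the table of the powers of two. -/
def powEntry : Term := lit 1 - var 0 + get 1 (var 0 - lit 1) * lit 2

variable (size : Term)

/-- The entries of the table of `gain`. -/
def gainEntry : Term :=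
  big .sup (pow resources)
    ((lit 1 - (
        big .sum resources (big .sum resources
          (get 0 (lit 2 + users * resources + var 1 * resources + var 0) *
            (digit (var 2) (var 1) * digit (var 2) (var 0)))) +
        big .sum resources (digit (var 1) (var 0) *
          (lit 1 - get 0 (lit 2 + var 2 / size * resources + var 0))) +
        big .sum resources (digit (get 2 (mod (var 2) size)) (var 0) *
          (lit 1 - digit (var 1) (var 0))))) *
      ((big .sum resources (digit (var 1) (var 0)) + lit 1) * pow (users * resources) +
        pow (var 1 / size * resources) * var 0))

/-- The mask of the elements of a set that are not in a cover mask. -/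
def diffEntry : Term :=
  big .sum resources (pow (var 0) * (digit (mod (var 2) (pow resources)) (var 0) *
    (lit 1 - digit (get 2 (var 1)) (var 0))))

/-- The entries of the table of `best`. -/
def bestEntry : Term :=
  (lit 1 - var 0 / pow resources) *
      ((lit 1 - mod (var 0) (pow resources)) * pow (users * resources)) +
    sign (var 0 / pow resources) * big .sup size (
      sign (get 4 ((var 1 / pow resources - lit 1) * pow resources + diffEntry)) *
      sign (get 3 ((var 1 / pow resources - lit 1) * size + var 0)) *
      (get 4 ((var 1 / pow resources - lit 1) * pow resources + diffEntry) +
        get 3 ((var 1 / pow resources - lit 1) * size + var 0)))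

/-- The optimum. -/
def optimum : Term := get 4 (users * pow resources + (pow resources - lit 1))

/-- The entries of the output. -/
def outputEntry : Term :=
  (lit 1 - var 0) * sign (get 5 (lit 0)) + sign (var 0) * digit (get 5 (lit 0)) (var 0 - lit 1)

end Term

open Term

/-- The program; `size` is the number of cover masks, and the terms `cover` are the cover masks. -/
def program (size cover : Term) : Program :=
  .seq (table 1 (users * resources + resources + lit 1) powEntry) <|
  .seq (table 2 size cover) <|
  .seq (table 3 (users * size) (gainEntry size)) <|
  .seq (table 4 ((users + lit 1) * pow resources) (bestEntry size)) <|
  .seq (table 5 (lit 1) optimum) <|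
  .seq ((lit 1 + users * resources * sign (get 5 (lit 0))).compile 0 0) <|
  .seq (.assign 0 (.var (tmpReg 0))) <|
  table 0 (users * resources + lit 1) outputEntry

/-! ### Values and step counts of the table entries -/

section Entries

variable {n k L sL : ℕ} {cm : ℕ → ℕ} {M : ℕ → ℕ → ℕ} {size : Term}

/-- The array `0` holds the input, and the array `1` holds powers of two. -/
structure Ready (n k : ℕ) (inp : ℕ → ℕ) (M : ℕ → ℕ → ℕ) : Prop where
  inp : M 0 = inp
  users : M 0 0 = n
  resources : M 0 1 = k
  pow : ∀ i ≤ n * k + k, M 1 i = 2 ^ i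

theorem digit_eval {inp : ℕ → ℕ} (h : Ready n k inp M) (x r : Term) (ρ : List ℕ)
    (hr : r.eval M ρ ≤ n * k + k) : (digit x r).eval M ρ = bit (x.eval M ρ) (r.eval M ρ) := by
  rw [bit_eq]
  simp only [digit, mod, Term.pow, eval_sub, eval_mul, eval_div, eval_get, eval_lit, h.pow _ hr]

/-- The table is flattened: position `i` belongs to the user `i / L` and the cover mask `i % L`. -/
theorem gainEntry_eval {inp : ℕ → ℕ} (h : Ready n k inp M) (hs : ∀ ρ, size.eval M ρ = L)
    (hcm : ∀ l < L, M 2 l = cm l) {i : ℕ} (hi : i < n * L) :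
    (gainEntry size).eval M [i] = gain n k (fun j r => inp (2 + j * k + r))
      (fun r r' => inp (2 + n * k + r * k + r')) cm (i / L) (i % L) := by
  have hL : 0 < L := Nat.pos_of_ne_zero (by rintro rfl; simp at hi)
  have hj : i / L < n := (Nat.div_lt_iff_lt_mul hL).2 hi
  have hjk : i / L * k ≤ n * k + k := by nlinarith
  have hmod : i - i / L * L = i % L := by
    have := Nat.div_add_mod' i L
    omega
  have hk : k ≤ n * k + k := by omega
  simp only [gainEntry, eval_sup, eval_sum, eval_mul, eval_add, eval_sub, eval_lit, eval_get,
    eval_div, users, resources, Term.pow, h.resources, h.users, h.pow k hk, hs, eval_var_zero,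
    eval_var_one, eval_var_two, h.pow _ hjk, h.pow (n * k) (by omega)]
  rw [gain]
  refine Finset.sup_congr rfl fun T _ => ?_
  rw [defect, weightOf, pop]
  refine congrArg₂ (· * ·) (congrArg₂ (· - ·) rfl (congrArg₂ (· + ·) (congrArg₂ (· + ·)
    (Finset.sum_congr rfl fun r hr => Finset.sum_congr rfl fun r' hr' => ?_)
    (Finset.sum_congr rfl fun r hr => ?_)) (Finset.sum_congr rfl fun r hr => ?_)))
    (congrArg₂ (· + ·) (congrArg₂ (· * ·) (congrArg₂ (· + ·)
      (Finset.sum_congr rfl fun r hr => ?_) rfl) rfl) rfl)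
  · have := Finset.mem_range.1 hr
    have := Finset.mem_range.1 hr'
    rw [digit_eval h _ _ _ (by simp only [eval_var_one]; omega),
      digit_eval h _ _ _ (by simp only [eval_var_zero]; omega), h.inp]
    simp only [eval_var_zero, eval_var_one, eval_var_two]
  · have := Finset.mem_range.1 hr
    rw [digit_eval h _ _ _ (by simp only [eval_var_zero]; omega), h.inp]
    simp only [eval_var_zero, eval_var_one]
  · have := Finset.mem_range.1 hr
    rw [digit_eval h _ _ _ (by simp only [eval_var_zero]; omega),
      digit_eval h _ _ _ (by simp only [eval_var_zero]; omega)]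
    simp only [eval_var_zero, eval_var_one, eval_var_two, eval_get, mod, eval_sub, eval_mul,
      eval_div, hs, hmod, hcm _ (Nat.mod_lt i hL)]
  · have := Finset.mem_range.1 hr
    rw [digit_eval h _ _ _ (by simp only [eval_var_zero]; omega)]
    simp only [eval_var_zero, eval_var_one]

theorem gainEntry_steps {inp : ℕ → ℕ} (h : Ready n k inp M) (hs : ∀ ρ, size.steps M ρ = sL)
    (i : ℕ) :
    (gainEntry size).steps M [i] ≤ (sL + 1) * 1000 * (2 ^ k * (k + 1) ^ 2) := by
  have hk : k ≤ n * k + k := by omega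
  simp only [gainEntry, steps_big, steps_mul, steps_add, steps_sub, steps_lit, steps_get,
    steps_div, users, resources, Term.pow, hs, steps_var, eval_get, eval_lit, h.pow k hk,
    h.resources,
    digit, mod, Finset.sum_const, Finset.card_range, smul_eq_mul]
  -- With `2 ^ k` written as `K + 1`, both sides expand to polynomials with natural coefficients,
  -- which are compared monomial by monomial.
  obtain ⟨K, hK⟩ : ∃ K, 2 ^ k = K + 1 := Nat.exists_eq_succ_of_ne_zero (by positivity)
  rw [hK]
  ring_nf
  omega

theorem sign_eval (e : Term) (ρ : List ℕ) : (sign e).eval M ρ = 1 - (1 - e.eval M ρ) := rfl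

/-- At `i = 0` the index `i - 1` is truncated, so the entry refers to itself; by `h0` it is still
`0` then, and the result is `1`. -/
theorem powEntry_eval {i : ℕ} (hp : ∀ j < i, M 1 j = 2 ^ j) (h0 : i = 0 → M 1 0 = 0) :
    powEntry.eval M [i] = 2 ^ i := by
  simp only [powEntry, eval_add, eval_sub, eval_mul, eval_get, eval_lit, eval_var_zero]
  cases i with
  | zero => simp [h0]
  | succ i => rw [Nat.add_sub_cancel, hp i (by omega), pow_succ]; omega

/-- Position `i` stands for the first `i / 2 ^ k` users and the set `i % 2 ^ k`. -/
theorem bestEntry_eval {inp : ℕ → ℕ} {base con : ℕ → ℕ → ℕ} (h : Ready n k inp M)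
    (hs : ∀ ρ, size.eval M ρ = L) (hcm : ∀ l < L, M 2 l = cm l)
    (hg : ∀ j < n, ∀ l < L, M 3 (j * L + l) = gain n k base con cm j l) {i : ℕ}
    (hi : i < (n + 1) * 2 ^ k)
    (hb : ∀ i' < i, M 4 i' = best n k L base con cm (i' / 2 ^ k) (i' % 2 ^ k)) :
    (bestEntry size).eval M [i] = best n k L base con cm (i / 2 ^ k) (i % 2 ^ k) := by
  have hk : k ≤ n * k + k := by omega
  have hK : 0 < 2 ^ k := by positivity
  have hj : i / 2 ^ k < n + 1 := (Nat.div_lt_iff_lt_mul hK).2 hi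
  have hmod : i - i / 2 ^ k * 2 ^ k = i % 2 ^ k := by
    have := Nat.div_add_mod' i (2 ^ k)
    omega
  have hdiff : ∀ l < L, diffEntry.eval M [l, i] = diff k (i % 2 ^ k) (cm l) := by
    intro l hl
    simp only [diffEntry, eval_sum, eval_mul, resources, Term.pow, eval_get, eval_lit,
      h.resources, eval_var_zero, eval_sub]
    refine Finset.sum_congr rfl fun r hr => ?_
    have := Finset.mem_range.1 hr
    rw [digit_eval h _ _ _ (by simp only [eval_var_zero]; omega),
      digit_eval h _ _ _ (by simp only [eval_var_zero]; omega), h.pow r (by omega)]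
    simp only [eval_var_zero, eval_var_one, eval_var_two, eval_get, mod, eval_sub, eval_mul,
      eval_div, eval_lit, h.resources, h.pow k hk, hmod, hcm l hl]
  simp only [bestEntry, eval_add, eval_mul, eval_sub, eval_lit, eval_div, eval_var_zero, mod,
    users, resources, Term.pow, eval_get, h.users, h.resources, h.pow k hk,
    h.pow (n * k) (by omega), hmod, eval_sup, sign_eval,
    hs, eval_var_one]
  rcases hq : i / 2 ^ k with - | j
  -- Without users, the maximum is multiplied by the sign of `0`, so the meaningless entries it
  -- reads do not matter.
  · simp [best]
  · have hle : 2 ^ k * (j + 1) ≤ i := by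
      rw [← hq]; exact Nat.mul_div_le i (2 ^ k)
    have h1 : 1 - (j + 1) = 0 := by omega
    have h2 : 1 - (1 - (j + 1)) = 1 := by omega
    rw [h2, h1, zero_mul, zero_add, one_mul, best]
    refine Finset.sup_congr rfl fun l hl => ?_
    have hl := Finset.mem_range.1 hl
    have hd := diff_lt k (i % 2 ^ k) (cm l)
    -- The entry lies in the block of `j` users, which ends before position `2 ^ k * (j + 1) ≤ i`,
    -- so it has been filled.
    have h3 : M 4 (j * 2 ^ k + diff k (i % 2 ^ k) (cm l)) =
        best n k L base con cm j (diff k (i % 2 ^ k) (cm l)) := by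
      rw [hb _ (by nlinarith), mul_comm, Nat.mul_add_div hK, Nat.mul_add_mod,
        Nat.div_eq_of_lt hd, Nat.mod_eq_of_lt hd, add_zero]
    rw [hdiff l hl, Nat.add_sub_cancel, h3, hg j (by omega) l hl]

theorem bestEntry_steps {inp : ℕ → ℕ} (h : Ready n k inp M) (hs : ∀ ρ, size.steps M ρ = sL)
    (hL : ∀ ρ, size.eval M ρ = L) (i : ℕ) :
    (bestEntry size).steps M [i] ≤ (sL + 1) * 1000 * ((L + 1) * (k + 1)) := by
  simp only [bestEntry, diffEntry, sign, steps_big, steps_mul, steps_add, steps_sub, steps_lit,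
    steps_get, steps_div, users, resources, Term.pow, hs, steps_var, eval_get, eval_lit, h.resources,
    digit, mod, hL, Finset.sum_const, Finset.card_range, smul_eq_mul]
  ring_nf
  omega

theorem optimum_eval {inp : ℕ → ℕ} {base con : ℕ → ℕ → ℕ} (h : Ready n k inp M)
    (hb : ∀ i < (n + 1) * 2 ^ k, M 4 i = best n k L base con cm (i / 2 ^ k) (i % 2 ^ k))
    (ρ : List ℕ) : optimum.eval M ρ = best n k L base con cm n (2 ^ k - 1) := by
  have hk : k ≤ n * k + k := by omega
  have hK : 0 < 2 ^ k := by positivity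
  have hd : 2 ^ k - 1 < 2 ^ k := by omega
  simp only [optimum, eval_get, eval_add, eval_sub, eval_mul, eval_lit, users, resources, Term.pow,
    h.users, h.resources, h.pow k hk]
  rw [hb _ (by rw [add_mul]; omega), mul_comm n, Nat.mul_add_div hK, Nat.mul_add_mod,
    Nat.div_eq_of_lt hd, Nat.mod_eq_of_lt hd, add_zero]

/-- The output for the optimum `v`. -/
def outputAt (v i : ℕ) : ℕ := (1 - i) * (1 - (1 - v)) + (1 - (1 - i)) * bit v (i - 1)

theorem outputEntry_eval {v i : ℕ} (hp : M 1 (i - 1) = 2 ^ (i - 1)) (hv : M 5 0 = v) :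
    outputEntry.eval M [i] = outputAt v i := by
  rw [outputAt, bit_eq]
  simp only [outputEntry, eval_add, eval_sub, eval_mul, sign_eval, eval_lit, eval_var_zero,
    eval_get, digit, mod, eval_div, Term.pow, hp, hv]

end Entries

/-! ### The run of the whole program -/

open Term

theorem Ready.fill {n k : ℕ} {inp : ℕ → ℕ} {M : ℕ → ℕ → ℕ} (h : Ready n k inp M) {a : ℕ}
    (h0 : 0 ≠ a) (h1 : 1 ≠ a) (f : ℕ → ℕ) (m : ℕ) : Ready n k inp (fill M a f m) := by
  refine ⟨?_, ?_, ?_, ?_⟩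
  · rw [fill_of_ne _ _ _ h0, h.inp]
  · rw [fill_of_ne _ _ _ h0, h.users]
  · rw [fill_of_ne _ _ _ h0, h.resources]
  · rw [fill_of_ne _ _ _ h1]; exact h.pow

theorem outputAt_le (v i : ℕ) : outputAt v i ≤ 1 := by
  unfold outputAt
  have := bit_le_one v (i - 1)
  rcases i with - | i
  · simp
  · rw [show 1 - (i + 1) = 0 by omega]; simpa using this

/-- The factor by which the bit length of the numbers grows in a run of the program. -/
def programWeight (size cover : Term) : ℕ :=
  (big .sum (users * resources + resources + lit 1) powEntry).weight +
  (big .sum size cover).weight +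
  (big .sum (users * size) (gainEntry size)).weight +
  (big .sum ((users + lit 1) * Term.pow resources) (bestEntry size)).weight +
  (big .sum (lit 1) optimum).weight +
  (lit 1 + users * resources * sign (get 5 (lit 0))).weight +
  (big .sum (users * resources + lit 1) outputEntry).weight

/-- The summands on the left are the step counts of the eight commands of `program`. The dominant
ones come from the tables of `gain` and `best`. -/
theorem sum_steps_le (n k L sL sC : ℕ) :
    12 + (n * k + k + 1) * 23 + (sL + 2 + L * (sC * (k + 1) + 3)) +
      (sL + 5 + n * L * ((sL + 1) * 1000 * (2 ^ k * (k + 1) ^ 2) + 3)) +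
      (10 + (n + 1) * 2 ^ k * ((sL + 1) * 1000 * ((L + 1) * (k + 1)) + 3)) + 36 + 14 + 1 +
      (9 + (n * k + 1) * 63) ≤
    (sL + sC + 1) * 10000 * ((L + 1) * 2 ^ k * (n + 1) * (k + 1) ^ 2) := by
  obtain ⟨K, hK⟩ : ∃ K, 2 ^ k = K + 1 := Nat.exists_eq_succ_of_ne_zero (by positivity)
  rw [hK]
  ring_nf
  omega

theorem program_exec {n k L sL sC : ℕ} {cm : ℕ → ℕ} {size cover : Term} {input : List ℕ}
    (hn : input.getD 0 0 = n) (hk : input.getD 1 0 = k)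
    (hinp : ∀ i, input.getD i 0 < 2 ^ (n * k + k + n + 2))
    (hsize : ∀ M, Ready n k (fun i => input.getD i 0) M → ∀ ρ, size.eval M ρ = L)
    (hsteps : ∀ M ρ, size.steps M ρ = sL)
    (hcover : ∀ M, Ready n k (fun i => input.getD i 0) M → ∀ l < L, cover.eval M [l] = cm l)
    (hcovers : ∀ M, Ready n k (fun i => input.getD i 0) M → ∀ l < L,
      cover.steps M [l] ≤ sC * (k + 1))
    (hcm : ∀ l < L, cm l < 2 ^ k) (v : ℕ)
    (hv : v = best n k L (fun j r => input.getD (2 + j * k + r) 0)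
      (fun r r' => input.getD (2 + n * k + r * k + r') 0) cm n (2 ^ k - 1)) :
    ∃ c, Runs (program size cover) input
        ((List.range (1 + n * k * (1 - (1 - v)))).map (outputAt v)) c ∧
      c ≤ (sL + sC + 1) * 10000 * ((L + 1) * 2 ^ k * (n + 1) * (k + 1) ^ 2) *
        unitCost (programWeight size cover * (n * k + k + n + 2)) := by
  set inp : ℕ → ℕ := fun i => input.getD i 0 with hinpdef
  set base : ℕ → ℕ → ℕ := fun j r => inp (2 + j * k + r)
  set con : ℕ → ℕ → ℕ := fun r r' => inp (2 + n * k + r * k + r')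
  set b := n * k + k + n + 2 with hb
  set W := programWeight size cover with hW
  have hb1 : 1 ≤ b := by omega
  have hmono : ∀ {x y : ℕ}, x ≤ y → 2 ^ x ≤ 2 ^ y := Nat.pow_le_pow_right (by norm_num)
  have hK : 0 < 2 ^ k := by positivity
  have hWb : ∀ {w : ℕ}, w ≤ W → w * b ≤ W * b := fun h => Nat.mul_le_mul_right _ h
  have hvb : v < 2 ^ b := hv ▸ best_lt _ le_rfl
  have e0 : (State.init input).arr 0 = inp := rfl
  have e0' : (State.init input).arr 1 = fun _ => 0 := rfl
  have hM0 : ∀ a i, (State.init input).arr a i < 2 ^ b := by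
    intro a i
    simp only [State.init]
    split_ifs
    · exact hinp i
    · positivity
  -- powers of two
  have hf1 : ∀ i < n * k + k + 1, 2 ^ i < 2 ^ b := fun i hi =>
    Nat.pow_lt_pow_right (by norm_num) (by omega)
  obtain ⟨c₁, σ₁, x₁, hc₁, hz₁, ha₁⟩ := table_exec (a := 1)
    (len := users * resources + resources + lit 1) (e := powEntry) (σ := State.init input)
    (n := n * k + k + 1) (s := 20) (W := W) (fun i => 2 ^ i) hb1 hM0
    (by simp only [users, resources, eval_add, eval_mul, eval_get, eval_lit, e0]
        simp only [inp, hn, hk])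
    (by simp only [hW, programWeight]; omega) hf1
    (fun i _ => powEntry_eval (fun j hj => by rw [fill_self, if_pos hj]) (by
      rintro rfl; rw [fill_zero, e0']))
    (fun i _ => by
      simp only [powEntry, steps_add, steps_sub, steps_mul, steps_lit, steps_var, steps_get]
      norm_num)
  have hM1 : ∀ a i, σ₁.arr a i < 2 ^ b := by rw [ha₁]; exact fill_lt hM0 hf1
  have hR1 : Ready n k inp σ₁.arr := by
    rw [ha₁]
    refine ⟨?_, ?_, ?_, fun i hi => ?_⟩
    · rw [fill_of_ne _ _ _ (by norm_num), e0]
    · rw [fill_of_ne _ _ _ (by norm_num), e0]; exact hn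
    · rw [fill_of_ne _ _ _ (by norm_num), e0]; exact hk
    · rw [fill_self, if_pos (by omega)]
  -- cover masks
  have hf2 : ∀ i < L, cm i < 2 ^ b := fun i hi => (hcm i hi).trans_le (hmono (by omega))
  obtain ⟨c₂, σ₂, x₂, hc₂, hz₂, ha₂⟩ := table_exec (a := 2) (len := size) (e := cover) (σ := σ₁)
    (n := L) (s := sC * (k + 1)) (W := W) cm hb1 hM1 (hsize _ hR1 _)
    (by simp only [hW, programWeight]; omega) hf2
    (fun i hi => hcover _ (hR1.fill (by norm_num) (by norm_num) _ _) i hi)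
    (fun i hi => hcovers _ (hR1.fill (by norm_num) (by norm_num) _ _) i hi)
  have hM2 : ∀ a i, σ₂.arr a i < 2 ^ b := by rw [ha₂]; exact fill_lt hM1 hf2
  have hR2 : Ready n k inp σ₂.arr := by
    rw [ha₂]; exact hR1.fill (by norm_num) (by norm_num) _ _
  have hC2 : ∀ l < L, σ₂.arr 2 l = cm l := fun l hl => by rw [ha₂, fill_self, if_pos hl]
  -- gains
  have hf3 : ∀ i < n * L, gain n k base con cm (i / L) (i % L) < 2 ^ b := fun i hi => by
    have hL : 0 < L := Nat.pos_of_ne_zero (by rintro rfl; simp at hi)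
    exact (gain_le ((Nat.div_lt_iff_lt_mul hL).2 hi) _).trans_lt
      (Nat.pow_lt_pow_right (by norm_num) (by omega))
  obtain ⟨c₃, σ₃, x₃, hc₃, hz₃, ha₃⟩ := table_exec (a := 3) (len := users * size)
    (e := gainEntry size) (σ := σ₂) (n := n * L) (s := (sL + 1) * 1000 * (2 ^ k * (k + 1) ^ 2))
    (W := W) (fun i => gain n k base con cm (i / L) (i % L)) hb1 hM2
    (by simp only [users, eval_mul, eval_get, eval_lit, hR2.users, hsize _ hR2])
    (by simp only [hW, programWeight]; omega) hf3
    (fun i hi => by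
      have hR := hR2.fill (a := 3) (by norm_num) (by norm_num)
        (fun i => gain n k base con cm (i / L) (i % L)) i
      exact gainEntry_eval hR (hsize _ hR)
        (fun l hl => by rw [fill_of_ne _ _ _ (by norm_num), hC2 l hl]) hi)
    (fun i hi => gainEntry_steps (hR2.fill (by norm_num) (by norm_num) _ _) (hsteps _) i)
  have hM3 : ∀ a i, σ₃.arr a i < 2 ^ b := by rw [ha₃]; exact fill_lt hM2 hf3
  have hR3 : Ready n k inp σ₃.arr := by
    rw [ha₃]; exact hR2.fill (by norm_num) (by norm_num) _ _
  have hC3 : ∀ l < L, σ₃.arr 2 l = cm l := fun l hl => by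
    rw [ha₃, fill_of_ne _ _ _ (by norm_num), hC2 l hl]
  have hG3 : ∀ j < n, ∀ l < L, σ₃.arr 3 (j * L + l) = gain n k base con cm j l := by
    intro j hj l hl
    rw [ha₃, fill_self, if_pos (by nlinarith), mul_comm, Nat.mul_add_div (by omega),
      Nat.mul_add_mod, Nat.div_eq_of_lt hl, Nat.mod_eq_of_lt hl, add_zero]
  -- the dynamic program
  have hf4 : ∀ i < (n + 1) * 2 ^ k, best n k L base con cm (i / 2 ^ k) (i % 2 ^ k) < 2 ^ b :=
    fun i hi => best_lt _ (Nat.lt_succ_iff.1 ((Nat.div_lt_iff_lt_mul hK).2 hi))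
  obtain ⟨c₄, σ₄, x₄, hc₄, hz₄, ha₄⟩ := table_exec (a := 4)
    (len := (users + lit 1) * Term.pow resources)
    (e := bestEntry size) (σ := σ₃) (n := (n + 1) * 2 ^ k)
    (s := (sL + 1) * 1000 * ((L + 1) * (k + 1)))
    (W := W) (fun i => best n k L base con cm (i / 2 ^ k) (i % 2 ^ k)) hb1 hM3
    (by simp only [users, resources, Term.pow, eval_add, eval_mul, eval_get, eval_lit, hR3.users,
      hR3.resources, hR3.pow k (by omega)])
    (by simp only [hW, programWeight]; omega) hf4
    (fun i hi => by
      have hR := hR3.fill (a := 4) (by norm_num) (by norm_num)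
        (fun i => best n k L base con cm (i / 2 ^ k) (i % 2 ^ k)) i
      exact bestEntry_eval hR (hsize _ hR)
        (fun l hl => by rw [fill_of_ne _ _ _ (by norm_num), hC3 l hl])
        (fun j hj l hl => by rw [fill_of_ne _ _ _ (by norm_num), hG3 j hj l hl]) hi
        (fun i' hi' => by rw [fill_self, if_pos hi']))
    (fun i hi => by
      have hR := hR3.fill (a := 4) (by norm_num) (by norm_num)
        (fun i => best n k L base con cm (i / 2 ^ k) (i % 2 ^ k)) i
      exact bestEntry_steps hR (hsteps _) (hsize _ hR) i)
  have hM4 : ∀ a i, σ₄.arr a i < 2 ^ b := by rw [ha₄]; exact fill_lt hM3 hf4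
  have hR4 : Ready n k inp σ₄.arr := by
    rw [ha₄]; exact hR3.fill (by norm_num) (by norm_num) _ _
  have hB4 : ∀ i < (n + 1) * 2 ^ k,
      σ₄.arr 4 i = best n k L base con cm (i / 2 ^ k) (i % 2 ^ k) := fun i hi => by
    rw [ha₄, fill_self, if_pos hi]
  -- the optimum
  obtain ⟨c₅, σ₅, x₅, hc₅, hz₅, ha₅⟩ := table_exec (a := 5) (len := lit 1)
    (e := optimum) (σ := σ₄) (n := 1) (s := 30) (W := W) (fun _ => v) hb1 hM4 rfl
    (by simp only [hW, programWeight]; omega) (fun _ _ => hvb)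
    (fun i hi => by
      rw [hv]
      exact optimum_eval (hR4.fill (by norm_num) (by norm_num) _ _)
        (fun i hi => by rw [fill_of_ne _ _ _ (by norm_num), hB4 i hi]) _)
    (fun i _ => by
      simp only [optimum, users, resources, Term.pow, steps_add, steps_sub, steps_mul, steps_lit,
        steps_get]
      norm_num)
  have hM5 : ∀ a i, σ₅.arr a i < 2 ^ b := by rw [ha₅]; exact fill_lt hM4 (fun _ _ => hvb)
  have hR5 : Ready n k inp σ₅.arr := by
    rw [ha₅]; exact hR4.fill (by norm_num) (by norm_num) _ _
  have hv5 : σ₅.arr 5 0 = v := by rw [ha₅, fill_self, if_pos (by norm_num)]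
  -- the length of the output
  obtain ⟨c₆, σ₆, x₆, hc₆, hA₆, hv₆⟩ := compile_exec
    (lit 1 + users * resources * sign (get 5 (lit 0))) [] 0 σ₅ b hb1 (by simp) hM5
    (by intro i hi; simp at hi)
  have hval : (lit 1 + users * resources * sign (get 5 (lit 0))).eval σ₅.arr [] =
      1 + n * k * (1 - (1 - v)) := by
    simp only [eval_add, eval_mul, sign_eval, users, resources, eval_get, eval_lit, hR5.users,
      hR5.resources, hv5]
  have hlt := eval_lt σ₅.arr (lit 1 + users * resources * sign (get 5 (lit 0))) [] b hb1 (by simp)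
    hM5
  have hw6 : (lit 1 + users * resources * sign (get 5 (lit 0))).weight ≤ W := by
    simp only [hW, programWeight]; omega
  have hsize6 := (Nat.size_le.2 hlt).trans (hWb hw6)
  set len := 1 + n * k * (1 - (1 - v)) with hlen
  rw [hval] at hv₆ hsize6
  have x₇ := Exec.assign σ₆ 0 (.var (tmpReg 0))
  have ha₇ : (σ₆.setReg 0 ((Expr.var (tmpReg 0)).eval σ₆)).arr = σ₅.arr := hA₆.arr
  have hz₇ : (σ₆.setReg 0 ((Expr.var (tmpReg 0)).eval σ₆)).reg 0 = len := by
    rw [reg_setReg_self, ← hv₆]; rfl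
  have hc₇ : 1 + (Expr.var (tmpReg 0)).cost σ₆ ≤ unitCost (W * b) := by
    apply le_unitCost
    simp only [Expr.cost, hv₆]
    omega
  -- the output
  have hf8 : ∀ i < n * k + 1, outputAt v i < 2 ^ b := fun i _ =>
    (outputAt_le v i).trans_lt (Nat.one_lt_two_pow (by omega))
  -- The output may overwrite the input in array `0`: the length of the table is read beforehand,
  -- and `outputEntry` uses only the arrays `1` and `5`. Register `0` keeps the output length, since
  -- filling a table does not change it.
  obtain ⟨c₈, σ₈, x₈, hc₈, hz₈, ha₈⟩ := table_exec (a := 0) (len := users * resources + lit 1)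
    (e := outputEntry) (σ := σ₆.setReg 0 ((Expr.var (tmpReg 0)).eval σ₆)) (n := n * k + 1)
    (s := 60) (W := W) (outputAt v) hb1 (by rw [ha₇]; exact hM5)
    (by simp only [ha₇, users, resources, eval_add, eval_mul, eval_get, eval_lit, hR5.users,
      hR5.resources])
    (by simp only [hW, programWeight]; omega) hf8
    (fun i hi => outputEntry_eval
      (by rw [fill_of_ne _ _ _ (by norm_num), ha₇, hR5.pow _ (by omega)])
      (by rw [fill_of_ne _ _ _ (by norm_num), ha₇, hv5]))
    (fun i _ => by
      simp only [outputEntry, sign, digit, mod, Term.pow, steps_add, steps_sub, steps_mul,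
        steps_lit, steps_get, steps_var, steps_div]
      norm_num)
  refine ⟨_, ⟨σ₈, x₁.seq (x₂.seq (x₃.seq (x₄.seq (x₅.seq (x₆.seq (x₇.seq x₈)))))), ?_⟩, ?_⟩
  · rw [State.output, hz₈, hz₇]
    refine List.map_congr_left fun i hi => ?_
    have hi := List.mem_range.1 hi
    have : n * k * (1 - (1 - v)) ≤ n * k :=
      (Nat.mul_le_mul_left _ (by omega : 1 - (1 - v) ≤ 1)).trans (by simp)
    rw [ha₈, fill_self, if_pos (by omega)]
  · have hc₆' := hc₆.trans (Nat.mul_le_mul_left _ (unitCost_mono (hWb hw6)))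
    simp only [sign, users, resources, Term.pow, steps_add, steps_sub, steps_mul, steps_lit,
      steps_get, hsteps] at hc₁ hc₂ hc₃ hc₄ hc₅ hc₆' hc₈
    refine (add_le_add hc₁ (add_le_add hc₂ (add_le_add hc₃ (add_le_add hc₄ (add_le_add hc₅
      (add_le_add hc₆' (add_le_add hc₇ hc₈))))))).trans ?_
    generalize unitCost (W * b) = u
    refine le_trans (le_of_eq ?_) (Nat.mul_le_mul_right u (sum_steps_le n k L sL sC))
    ring

/-! ### Encodings -/

theorem length_flatMap_const {α : Type} (l : List α) (f : α → List ℕ) (b : ℕ)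
    (hf : ∀ x, (f x).length = b) : (l.flatMap f).length = l.length * b := by
  induction l with
  | nil => simp
  | cons x l ih => simp [ih, hf, add_mul, add_comm]

theorem getElem?_flatMap_const {α : Type} (f : α → List ℕ) (b : ℕ)
    (hf : ∀ x, (f x).length = b) (l : List α) (i j : ℕ) (hi : i < l.length) (hj : j < b) :
    (l.flatMap f)[i * b + j]? = (f l[i])[j]? := by
  induction l generalizing i with
  | nil => simp at hi
  | cons x l ih =>
    rw [List.flatMap_cons]
    cases i with
    | zero => rw [List.getElem?_append_left (by simp [hf, hj])]; simp
    | succ i =>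
      rw [List.getElem?_append_right (by rw [hf, add_mul]; omega), hf]
      rw [show (i + 1) * b + j - b = i * b + j by rw [add_mul]; omega]
      simpa using ih i (by simpa using hi)

section Matrix

variable {a b : ℕ} (S : Finset (Fin a × Fin b))

theorem length_encodeMatrix : (encodeMatrix S).length = a * b := by
  rw [encodeMatrix, length_flatMap_const _ _ b (by simp), List.length_finRange]

theorem getElem?_encodeMatrix (i : Fin a) (j : Fin b) :
    (encodeMatrix S)[(i : ℕ) * b + j]? = some (if (i, j) ∈ S then 1 else 0) := by
  rw [encodeMatrix, getElem?_flatMap_const _ b (by simp) _ _ _ (by simp) j.2]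
  simp

theorem getD_encodeMatrix (i : Fin a) (j : Fin b) :
    (encodeMatrix S).getD (i * b + j) 0 = if (i, j) ∈ S then 1 else 0 := by
  rw [List.getD_eq_getElem?_getD, getElem?_encodeMatrix, Option.getD_some]

theorem le_one_of_mem_encodeMatrix {x : ℕ} (h : x ∈ encodeMatrix S) : x ≤ 1 := by
  simp only [encodeMatrix, List.mem_flatMap, List.mem_map] at h
  obtain ⟨i, -, j, -, rfl⟩ := h
  split_ifs <;> simp

theorem encodeMatrix_eq_map (f : ℕ → ℕ)
    (hf : ∀ (i : Fin a) (j : Fin b), f (i * b + j) = if (i, j) ∈ S then 1 else 0) :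
    encodeMatrix S = (List.range (a * b)).map f := by
  apply List.ext_getElem?
  intro m
  by_cases hm : m < a * b
  · have hb : 0 < b := Nat.pos_of_ne_zero (by rintro rfl; simp at hm)
    have h := getElem?_encodeMatrix S ⟨m / b, (Nat.div_lt_iff_lt_mul hb).2 hm⟩
      ⟨m % b, Nat.mod_lt _ hb⟩
    have h' := hf ⟨m / b, (Nat.div_lt_iff_lt_mul hb).2 hm⟩ ⟨m % b, Nat.mod_lt _ hb⟩
    simp only [Nat.div_add_mod'] at h h'
    rw [h, ← h']
    simp [hm]
  · rw [List.getElem?_eq_none (by rw [length_encodeMatrix]; omega),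
      List.getElem?_eq_none (by simp; omega)]

end Matrix

section Instance

variable (I : Instance) (rest : List ℕ)

theorem length_encodeInstance : (encodeInstance I).length = 2 + I.n * I.k + I.k * I.k := by
  simp [encodeInstance, length_encodeMatrix]; omega

theorem getD_input_zero : (encodeInstance I ++ rest).getD 0 0 = I.n := by
  simp [encodeInstance]

theorem getD_input_one : (encodeInstance I ++ rest).getD 1 0 = I.k := by
  simp [encodeInstance]

theorem mul_add_lt {a b : ℕ} (j : Fin a) (r : Fin b) : (j : ℕ) * b + r < a * b := by
  have := Nat.mul_le_mul_right b (Nat.succ_le_of_lt j.2)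
  have := r.2
  rw [Nat.succ_mul] at *
  omega

theorem getD_input_base (j : Fin I.n) (r : Fin I.k) :
    (encodeInstance I ++ rest).getD (2 + j * I.k + r) 0 = if (j, r) ∈ I.base then 1 else 0 := by
  have h := mul_add_lt j r
  rw [List.getD_append _ _ _ _ (by rw [length_encodeInstance]; omega), encodeInstance,
    List.getD_append _ _ _ _ (by simp [length_encodeMatrix]; omega),
    List.getD_append_right _ _ _ _ (by simp; omega), ← getD_encodeMatrix]
  congr 1
  simp; omega

theorem getD_input_constraints (r r' : Fin I.k) :
    (encodeInstance I ++ rest).getD (2 + I.n * I.k + r * I.k + r') 0 =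
      if (⟨r, r', .xor, .all⟩ : Constraint (Fin I.k)) ∈ I.constraints then 1 else 0 := by
  have h := mul_add_lt r r'
  rw [List.getD_append _ _ _ _ (by rw [length_encodeInstance]; omega), encodeInstance,
    List.getD_append_right _ _ _ _ (by simp [length_encodeMatrix]; omega)]
  have := getD_encodeMatrix (Finset.univ.filter fun p : Fin I.k × Fin I.k =>
      (⟨p.1, p.2, .xor, .all⟩ : Constraint (Fin I.k)) ∈ I.constraints) r r'
  simp only [Finset.mem_filter, Finset.mem_univ, true_and] at this
  rw [← this]
  congr 1
  simp [length_encodeMatrix]; omega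

theorem getD_input_lt (hrest : ∀ x ∈ rest, x ≤ 1) (i : ℕ) :
    (encodeInstance I ++ rest).getD i 0 < 2 ^ (I.n * I.k + I.k + I.n + 2) := by
  have h1 : I.n + I.k + 1 < 2 ^ (I.n * I.k + I.k + I.n + 2) :=
    lt_of_le_of_lt (by omega) (Nat.lt_two_pow_self)
  refine lt_of_le_of_lt ?_ h1
  rw [List.getD_eq_getElem?_getD]
  rcases h : (encodeInstance I ++ rest)[i]? with - | x
  · simp
  · have := List.mem_of_getElem? h
    simp only [encodeInstance, List.mem_append, List.mem_cons, List.not_mem_nil, or_false] at this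
    rw [Option.getD_some]
    rcases this with (((rfl | rfl) | h) | h) | h
    · omega
    · omega
    · have := le_one_of_mem_encodeMatrix _ h; omega
    · have := le_one_of_mem_encodeMatrix _ h; omega
    · have := hrest x h; omega

end Instance

/-! ### Valid relations and masks -/

/-- For a family of cover masks: every user has a cover mask contained in the set of their resources
in `A`, and these masks cover all resources. -/
def Covers {n k : ℕ} (L : ℕ) (cm : ℕ → ℕ) (A : Finset (Fin n × Fin k)) : Prop :=
  ∃ l : Fin n → ℕ, (∀ j, l j < L) ∧ (∀ j (r : Fin k), (cm (l j)).testBit r → (j, r) ∈ A) ∧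
    ∀ r : Fin k, ∃ j, (cm (l j)).testBit r

/-- Answers for a family of cover masks: a largest one of the valid relations covered by it. -/
def IsCoverAnswer (I : Instance) (L : ℕ) (cm : ℕ → ℕ) : Answer I → Prop
  | some A => Valid I.base I.constraints A ∧ Covers L cm A ∧
      ∀ B, Valid I.base I.constraints B → Covers L cm B → B.card ≤ A.card
  | none => ∀ B, Valid I.base I.constraints B → ¬ Covers L cm B

theorem mem_usersOf {U R : Type} [Fintype U] [DecidableEq U] [DecidableEq R]
    {A : Finset (U × R)} {u : U} {r : R} : u ∈ usersOf A r ↔ (u, r) ∈ A := by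
  simp [usersOf]

/-- In this form the constraints concern the row of each user separately and visibly pass to
subrelations. -/
theorem eligible_iff {U R : Type} [Fintype U] [DecidableEq U] [DecidableEq R]
    {C : Finset (Constraint R)} (hC : ∀ c ∈ C, c ∈ SoDU R) {A : Finset (U × R)} :
    Eligible C A ↔ ∀ r r', (⟨r, r', .xor, .all⟩ : Constraint R) ∈ C →
      ∀ u, (u, r) ∈ A → (u, r') ∈ A → False := by
  constructor
  · intro h r r' hc u hr hr'
    have := h _ hc
    simp only [Satisfies, mem_usersOf, Finset.mem_union, Connective.eval] at this
    have := this u (Or.inl hr)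
    simp [Xor, hr, hr'] at this
  · intro h c hc
    obtain ⟨r, r', o, q⟩ := c
    obtain ⟨ho, hq⟩ := hC _ hc
    simp only at ho hq
    subst ho hq
    simp only [Satisfies, mem_usersOf, Finset.mem_union, Connective.eval]
    intro u hu
    have := h r r' hc u
    simp only [Xor]
    tauto

/-- The mask of the resources of the user `j` in `A`. -/
def rowMask {n k : ℕ} (A : Finset (Fin n × Fin k)) (j : ℕ) : ℕ :=
  ∑ r ∈ Finset.range k, 2 ^ r *
    if ∃ (hj : j < n) (hr : r < k), ((⟨j, hj⟩ : Fin n), (⟨r, hr⟩ : Fin k)) ∈ A then 1 else 0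

section Rows

variable {n k : ℕ}

theorem rowMask_lt (A : Finset (Fin n × Fin k)) (j : ℕ) : rowMask A j < 2 ^ k :=
  sum_two_pow_mul_lt _ (fun r => by split_ifs <;> simp) k

theorem testBit_rowMask (A : Finset (Fin n × Fin k)) (j : Fin n) (r : Fin k) :
    (rowMask A j).testBit r ↔ (j, r) ∈ A := by
  rw [rowMask, testBit_sum_two_pow_mul _ (fun r => by split_ifs <;> simp)]
  simp

theorem card_eq_sum_pop (A : Finset (Fin n × Fin k)) (T : ℕ → ℕ)
    (hT : ∀ (j : Fin n) (r : Fin k), (T j).testBit r ↔ (j, r) ∈ A) :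
    A.card = ∑ j ∈ Finset.range n, pop k (T j) := by
  have h : A.card = ∑ p : Fin n × Fin k, if p ∈ A then 1 else 0 := by
    rw [Finset.sum_ite_mem, Finset.univ_inter, Finset.card_eq_sum_ones]
  rw [h, Fintype.sum_prod_type, Finset.sum_range]
  refine Finset.sum_congr rfl fun j _ => ?_
  rw [pop, Finset.sum_range]
  refine Finset.sum_congr rfl fun r _ => ?_
  simp only [bit, ← hT]
  cases (T j).testBit r <;> simp

/-- The offset `n + 1` is the same for all choices, and the last sum stays below `2 ^ (n * k)` for
masks below `2 ^ k`. Comparing totals therefore compares cardinalities before anything else. -/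
theorem total_eq (T : ℕ → ℕ) : total n k n T =
    2 ^ (n * k) * (∑ j ∈ Finset.range n, pop k (T j) + n + 1) +
      ∑ j ∈ Finset.range n, 2 ^ (j * k) * T j := by
  simp only [total, weightOf, Finset.sum_add_distrib, ← Finset.sum_mul, Finset.sum_const,
    Finset.card_range, smul_eq_mul]
  ring

end Rows

/-- The rows of a covered valid relation form a feasible choice, which bounds `v` from below;
conversely, a nonzero `v` is the total of a feasible choice whose rows make up a valid covered
relation. The output is read off the digits of `v`, so it is that very relation. -/
theorem exists_coverAnswer (I : Instance) (hI : ∀ c ∈ I.constraints, c ∈ SoDU (Fin I.k)) (L : ℕ)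
    (cm : ℕ → ℕ) (hcm : ∀ l < L, cm l < 2 ^ I.k) (base con : ℕ → ℕ → ℕ)
    (hbase : ∀ (j : Fin I.n) (r : Fin I.k), base j r = if (j, r) ∈ I.base then 1 else 0)
    (hcon : ∀ r r' : Fin I.k, con r r' =
      if (⟨r, r', .xor, .all⟩ : Constraint (Fin I.k)) ∈ I.constraints then 1 else 0)
    (v : ℕ) (hv : v = best I.n I.k L base con cm I.n (2 ^ I.k - 1)) :
    ∃ a : Answer I, IsCoverAnswer I L cm a ∧ encodeAnswer a =
      (List.range (1 + I.n * I.k * (1 - (1 - v)))).map (outputAt v) := by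
  obtain ⟨n, k, B, hB, C⟩ := I
  simp only at *
  have hK : 0 < 2 ^ k := by positivity
  have hfull : ∀ r < k, (2 ^ k - 1).testBit r := fun r hr => by
    rw [Nat.testBit_two_pow_sub_one]; simpa using hr
  -- covered valid relations bound the optimum from below
  have hlow : ∀ A, Valid B C A → Covers L cm A →
      total n k n (rowMask A) ≤ v := by
    rintro A ⟨hA, -, hE⟩ ⟨l, hl, hlA, hlc⟩
    rw [eligible_iff hI] at hE
    have hF : Feasible k L base con cm n (rowMask A) (fun j => if h : j < n then l ⟨j, h⟩ else 0) := by
      intro j hj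
      simp only [hj, dite_true]
      refine ⟨hl _, rowMask_lt A j, ?_⟩
      rw [defect_eq_zero]
      refine ⟨fun r hr r' hr' hc h1 h2 => ?_, fun r hr h1 => ?_, fun r hr h1 => ?_⟩
      · have h1 := (testBit_rowMask A ⟨j, hj⟩ ⟨r, hr⟩).1 h1
        have h2 := (testBit_rowMask A ⟨j, hj⟩ ⟨r', hr'⟩).1 h2
        refine hE _ _ ?_ _ h1 h2
        by_contra hn
        exact hc ((hcon ⟨r, hr⟩ ⟨r', hr'⟩).trans (if_neg hn))
      · have h1 := (testBit_rowMask A ⟨j, hj⟩ ⟨r, hr⟩).1 h1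
        rw [hbase ⟨j, hj⟩ ⟨r, hr⟩, if_pos (hA h1)]
        exact one_ne_zero
      · exact (testBit_rowMask A ⟨j, hj⟩ ⟨r, hr⟩).2 (hlA ⟨j, hj⟩ ⟨r, hr⟩ h1)
    rw [hv]
    refine total_le_best hF (by omega) fun r hr _ => ?_
    obtain ⟨j, hj⟩ := hlc ⟨r, hr⟩
    exact ⟨j, j.2, by simpa using hj⟩
  by_cases h0 : v = 0
  · refine ⟨none, fun A hA hc => ?_, ?_⟩
    · have := hlow A hA hc
      have : 0 < total n k n (rowMask A) := by unfold total; positivity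
      omega
    · subst h0
      simp [encodeAnswer, outputAt]
  obtain ⟨T, l, hF, hc, hT⟩ := exists_of_best_ne_zero (by omega) (hv ▸ h0)
  rw [← hv] at hT
  set A : Finset (Fin n × Fin k) := Finset.univ.filter fun p => (T p.1).testBit p.2 with hA
  have hmem : ∀ (j : Fin n) (r : Fin k), (T j).testBit r ↔ (j, r) ∈ A := by simp [hA]
  have hTk : ∀ j < n, T j < 2 ^ k := fun j hj => (hF j hj).2.1
  have hcov : Covers L cm A := by
    refine ⟨fun j => l j, fun j => (hF j j.2).1, fun j r h => ?_, fun r => ?_⟩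
    · exact (hmem j r).1 (((defect_eq_zero _ _ _ _ _ _).1 (hF j j.2).2.2).2.2 r r.2 h)
    · obtain ⟨j, hj, h⟩ := hc r r.2 (hfull r r.2)
      exact ⟨⟨j, hj⟩, h⟩
  have hlt := sum_two_pow_mul_lt' T k n hTk
  refine ⟨some A, ⟨⟨?_, ?_, ?_⟩, hcov, ?_⟩, ?_⟩
  · rintro ⟨j, r⟩ h
    have := ((defect_eq_zero _ _ _ _ _ _).1 (hF j j.2).2.2).2.1 r r.2 ((hmem j r).2 h)
    by_contra hn
    exact this ((hbase j r).trans (if_neg hn))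
  · obtain ⟨l, -, h1, h2⟩ := hcov
    intro r
    obtain ⟨j, hj⟩ := h2 r
    exact ⟨j, mem_usersOf.2 (h1 j r hj)⟩
  · rw [eligible_iff hI]
    intro r r' hc j h1 h2
    refine ((defect_eq_zero _ _ _ _ _ _).1 (hF j j.2).2.2).1 r r.2 r' r'.2 ?_ ((hmem j r).2 h1)
      ((hmem j r').2 h2)
    rw [hcon, if_pos hc]
    exact one_ne_zero
  · intro A' hA' hc'
    have h1 := hlow A' hA' hc'
    rw [hT, total_eq, total_eq, ← card_eq_sum_pop A T hmem,
      ← card_eq_sum_pop A' _ (testBit_rowMask A')] at h1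
    by_contra hlt'
    -- One more element would raise the leading part by at least `2 ^ (n * k)`, more than the last
    -- `n * k` digits of `v` can make up for.
    have h2 := Nat.mul_le_mul_left (2 ^ (n * k)) (show A.card + n + 1 + 1 ≤ A'.card + n + 1 by omega)
    rw [Nat.mul_succ] at h2
    omega
  · have h1 : 1 - (1 - v) = 1 := by omega
    -- Output entry `0` is the sign of `v`; the other entries are the digits of `v`, shifted by one
    -- place.
    rw [encodeAnswer, h1, mul_one, add_comm, List.range_succ_eq_map, List.map_cons, List.map_map]
    congr 1
    · simp [outputAt, h1]
    · refine encodeMatrix_eq_map A _ fun j r => ?_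
      have h2 := mul_add_lt j r
      simp only [Function.comp, outputAt, Nat.succ_eq_add_one, Nat.add_sub_cancel]
      rw [show 1 - ((j : ℕ) * k + r + 1) = 0 by omega, zero_mul, zero_add, Nat.sub_zero, one_mul,
        hT, total_eq, bit, Nat.testBit_two_pow_mul_add _ hlt, if_pos h2,
        testBit_sum_two_pow_mul' T k n hTk j r j.2 r.2]
      simp only [← hmem]
      cases (T j).testBit r <;> simp

open Term

theorem program_solves (I : Instance) (hI : ∀ c ∈ I.constraints, c ∈ SoDU (Fin I.k))
    {rest : List ℕ} (hrest : ∀ x ∈ rest, x ≤ 1) {L sL sC : ℕ} {cm : ℕ → ℕ} {size cover : Term}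
    (hcm : ∀ l < L, cm l < 2 ^ I.k)
    (hsize : ∀ M, Ready I.n I.k (fun i => (encodeInstance I ++ rest).getD i 0) M →
      ∀ ρ, size.eval M ρ = L)
    (hsteps : ∀ M ρ, size.steps M ρ = sL)
    (hcover : ∀ M, Ready I.n I.k (fun i => (encodeInstance I ++ rest).getD i 0) M →
      ∀ l < L, cover.eval M [l] = cm l)
    (hcovers : ∀ M, Ready I.n I.k (fun i => (encodeInstance I ++ rest).getD i 0) M →
      ∀ l < L, cover.steps M [l] ≤ sC * (I.k + 1)) :
    ∃ (a : Answer I) (c : ℕ), IsCoverAnswer I L cm a ∧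
      Runs (program size cover) (encodeInstance I ++ rest) (encodeAnswer a) c ∧
      c ≤ (sL + sC + 1) * 10000 * ((L + 1) * 2 ^ I.k * (I.n + 1) * (I.k + 1) ^ 2) *
        unitCost (programWeight size cover * (I.n * I.k + I.k + I.n + 2)) := by
  obtain ⟨a, ha, hout⟩ := exists_coverAnswer I hI L cm hcm
    (fun j r => (encodeInstance I ++ rest).getD (2 + j * I.k + r) 0)
    (fun r r' => (encodeInstance I ++ rest).getD (2 + I.n * I.k + r * I.k + r') 0)
    (getD_input_base I rest) (getD_input_constraints I rest) _ rfl
  obtain ⟨c, hc, hcc⟩ := program_exec (getD_input_zero I rest) (getD_input_one I rest)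
    (getD_input_lt I rest hrest) hsize hsteps hcover hcovers hcm _ rfl
  exact ⟨a, c, ha, hout ▸ hc, hcc⟩

/-! ### Time bounds -/

/-- The polynomial factor of the running time. -/
noncomputable def timePoly (s w : ℕ) : Polynomial ℕ :=
  .C (s * 400000) * (.X + 1) ^ 4 * (.C (2 * w) * (.X + 1) ^ 2 + 1) ^ 2

/-- The slack `4 * (k + 1)` in `hF` is absorbed by the polynomial; small `k` need it, as `2 ^ k`
exceeds `k ^ k` at `k = 1`. -/
theorem time_le {I : Instance} {c s w L : ℕ} {F : ℝ}
    (hc : c ≤ s * 10000 * ((L + 1) * 2 ^ I.k * (I.n + 1) * (I.k + 1) ^ 2) *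
        unitCost (w * (I.n * I.k + I.k + I.n + 2)))
    (hF : ((L : ℝ) + 1) * 2 ^ I.k ≤ F * (4 * (I.k + 1))) (hF0 : 0 ≤ F) :
    (c : ℝ) ≤ F * (((timePoly s w).eval I.size : ℕ) : ℝ) := by
  have hn : I.n ≤ I.size := by unfold Instance.size; omega
  have hk : I.k ≤ I.size := by unfold Instance.size; omega
  generalize I.size = N at hn hk
  have h1 : I.n * I.k + I.k + I.n + 2 ≤ 2 * (N + 1) ^ 2 := by
    have : (I.n + 1) * (I.k + 1) ≤ (N + 1) * (N + 1) := by gcongr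
    nlinarith
  have h2 : unitCost (w * (I.n * I.k + I.k + I.n + 2)) ≤ 10 * (2 * w * (N + 1) ^ 2 + 1) ^ 2 := by
    unfold unitCost
    have := Nat.mul_le_mul_left w h1
    exact Nat.mul_le_mul_left 10 (Nat.pow_le_pow_left (by linarith) 2)
  have h3 : c ≤ s * 10000 * ((L + 1) * 2 ^ I.k * (N + 1) * (N + 1) ^ 2) *
      (10 * (2 * w * (N + 1) ^ 2 + 1) ^ 2) := by
    refine hc.trans (Nat.mul_le_mul ?_ h2)
    gcongr
  have h4 : (c : ℝ) ≤ s * 10000 * ((L + 1) * 2 ^ I.k * (N + 1) * (N + 1) ^ 2) *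
      (10 * (2 * w * (N + 1) ^ 2 + 1) ^ 2) := by exact_mod_cast h3
  refine h4.trans ?_
  have hkN : (I.k : ℝ) ≤ N := by exact_mod_cast hk
  have h5 : ((L : ℝ) + 1) * 2 ^ I.k ≤ F * (4 * (N + 1)) :=
    hF.trans (by gcongr)
  have h6 : (s : ℝ) * 10000 * ((L + 1) * 2 ^ I.k * (N + 1) * (N + 1) ^ 2) *
      (10 * (2 * w * (N + 1) ^ 2 + 1) ^ 2) ≤
      s * 10000 * (F * (4 * (N + 1)) * (N + 1) * (N + 1) ^ 2) *
      (10 * (2 * w * (N + 1) ^ 2 + 1) ^ 2) := by gcongr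
  refine h6.trans (le_of_eq ?_)
  simp only [timePoly, Polynomial.eval_mul, Polynomial.eval_pow, Polynomial.eval_add,
    Polynomial.eval_C, Polynomial.eval_X, Polynomial.eval_one]
  push_cast
  ring

theorem two_pow_add_one_mul_le (k : ℕ) : (((2 ^ k : ℕ) : ℝ) + 1) * 2 ^ k ≤
    (2 : ℝ) ^ ((k : ℝ) + (k : ℝ) * Real.logb 2 (k : ℝ)) * (4 * (k + 1)) := by
  rcases Nat.eq_zero_or_pos k with rfl | hk
  · norm_num
  have hk' : (0 : ℝ) < k := by exact_mod_cast hk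
  have h1 : (2 : ℝ) ^ ((k : ℝ) + (k : ℝ) * Real.logb 2 (k : ℝ)) = 2 ^ k * (k : ℝ) ^ k := by
    rw [Real.rpow_add (by norm_num), Real.rpow_natCast, mul_comm (k : ℝ) (Real.logb _ _),
      Real.rpow_mul (by norm_num), Real.rpow_logb (by norm_num) (by norm_num) hk',
      Real.rpow_natCast]
  have h2 : (2 : ℝ) ^ k ≤ 2 * (k : ℝ) ^ k := by
    rcases Nat.lt_or_ge k 2 with h | h
    · obtain rfl : k = 1 := by omega
      norm_num
    · have h' : (2 : ℝ) ≤ k := by exact_mod_cast h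
      have : (2 : ℝ) ^ k ≤ (k : ℝ) ^ k := by gcongr
      linarith [pow_pos hk' k]
  have h3 : (1 : ℝ) ≤ 2 ^ k := one_le_pow₀ (by norm_num)
  rw [h1]
  push_cast
  have h4 : (2 : ℝ) ^ k + 1 ≤ (k : ℝ) ^ k * (4 * (k + 1)) := by
    have := pow_pos hk' k
    nlinarith
  calc ((2 : ℝ) ^ k + 1) * 2 ^ k ≤ ((k : ℝ) ^ k * (4 * (k + 1))) * 2 ^ k := by gcongr
    _ = _ := by ring

/-! ### Finding a largest valid relation -/

/-- Each user takes their entire row as cover mask, so admitting all masks excludes no valid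
relation. -/
theorem covers_two_pow {n k : ℕ} {C : Finset (Constraint (Fin k))} {B A : Finset (Fin n × Fin k)}
    (hA : Valid B C A) : Covers (2 ^ k) id A := by
  refine ⟨fun j => rowMask A j, fun j => rowMask_lt A j,
    fun j r h => (testBit_rowMask A j r).1 h, fun r => ?_⟩
  obtain ⟨j, hj⟩ := hA.2.1 r
  exact ⟨j, (testBit_rowMask A j r).2 (mem_usersOf.1 hj)⟩

theorem solves_maximum : ∃ (c : Program) (p : Polynomial ℕ), ∀ I : SoDUInstance,
    ∃ (a : Answer I.1) (t : ℕ), IsMaxAnswer I.1 a ∧ Runs c (encodeInstance I.1) (encodeAnswer a) t ∧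
      (t : ℝ) ≤ (2 : ℝ) ^ ((I.1.k : ℝ) + (I.1.k : ℝ) * Real.logb 2 (I.1.k : ℝ)) *
        ((p.eval I.1.size : ℕ) : ℝ) := by
  refine ⟨program (Term.pow resources) (var 0),
    timePoly (3 + 1 + 1) (programWeight (Term.pow resources) (var 0)), fun I => ?_⟩
  obtain ⟨a, c, ha, hr, hc⟩ := program_solves I.1 I.2 (rest := []) (by simp) (L := 2 ^ I.1.k)
    (sL := 3) (sC := 1) (cm := id) (size := Term.pow resources) (cover := var 0) (fun l hl => hl)
    (fun M h ρ => by
      simp only [Term.pow, resources, eval_get, eval_lit, h.resources, h.pow I.1.k (by omega)])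
    (fun M ρ => rfl) (fun M h l hl => rfl) (fun M h l hl => by rw [steps_var]; omega)
  rw [List.append_nil] at hr
  refine ⟨a, c, ?_, hr, time_le hc (two_pow_add_one_mul_le _) (by positivity)⟩
  cases a with
  | none => exact fun B hB => ha B hB (covers_two_pow hB)
  | some A => exact ⟨ha.1, fun B hB => ha.2.2 B hB (covers_two_pow hB)⟩

/-! ### Finding a largest valid relation for a pattern -/

theorem mem_part_pattern {R U : Type} [Fintype U] [DecidableEq U] [Fintype R] [DecidableEq R]
    (π : R → U) (r r' : R) : r' ∈ (pattern π).part r ↔ π r = π r' := by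
  unfold pattern
  rw [Finpartition.mem_part_ofSetoid_iff_rel]
  rfl

theorem finpartition_eq_of_part {R : Type} [Fintype R] [DecidableEq R]
    {P Q : Finpartition (Finset.univ : Finset R)} (h : ∀ r, P.part r = Q.part r) : P = Q := by
  have key : ∀ (P Q : Finpartition (Finset.univ : Finset R)), (∀ r, P.part r = Q.part r) →
      ∀ s ∈ P.parts, s ∈ Q.parts := by
    intro P Q h s hs
    obtain ⟨r, -, rfl⟩ := P.part_surjOn hs
    rw [h]
    exact Q.part_mem.2 (Finset.mem_univ r)
  ext s
  exact ⟨key P Q h s, key Q P (fun r => (h r).symm) s⟩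

theorem valid_graph {U R : Type} [Fintype U] [DecidableEq U] [Fintype R] [DecidableEq R]
    {B A : Finset (U × R)} {C : Finset (Constraint R)} (hC : ∀ c ∈ C, c ∈ SoDU R)
    (hA : Valid B C A) {π : R → U} (h : Contains A π) : Valid B C (graph π) := by
  have hsub : graph π ⊆ A := by
    intro x hx
    obtain ⟨r, -, rfl⟩ := Finset.mem_image.1 hx
    exact h r
  refine ⟨hsub.trans hA.1, fun r => ⟨π r, mem_usersOf.2 ?_⟩, ?_⟩
  · exact Finset.mem_image_of_mem _ (Finset.mem_univ r)
  · rw [eligible_iff hC]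
    intro r r' hc u h1 h2
    exact (eligible_iff hC).1 hA.2.2 r r' hc u (hsub h1) (hsub h2)

theorem contains_graph {U R : Type} [Fintype U] [DecidableEq U] [Fintype R] [DecidableEq R]
    (π : R → U) : Contains (graph π) π :=
  fun r => Finset.mem_image_of_mem (fun r => (π r, r)) (Finset.mem_univ r)

section Pattern

variable {n k : ℕ} {P : Finpartition (Finset.univ : Finset (Fin k))} {cm : ℕ → ℕ}
  {A : Finset (Fin n × Fin k)}

/-- A user in the range of `π` takes the class of the resources that `π` gives them; everyone else
takes the empty mask, which has index `k`. -/
theorem covers_of_contains (hk : cm k = 0)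
    (hcm : ∀ l r : Fin k, (cm l).testBit r ↔ r ∈ P.part l) {π : Fin k → Fin n}
    (hπ : pattern π = P) (hA : Contains A π) : Covers (k + 1) cm A := by
  classical
  subst hπ
  simp only [mem_part_pattern] at hcm
  refine ⟨fun j => if h : ∃ r, π r = j then (h.choose : ℕ) else k, fun j => ?_, fun j r h => ?_,
    fun r => ⟨π r, ?_⟩⟩
  · dsimp only
    split_ifs with h
    · exact h.choose.2.trans (Nat.lt_succ_self k)
    · exact Nat.lt_succ_self k
  · dsimp only at h
    split_ifs at h with h'
    · rw [hcm, h'.choose_spec] at h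
      rw [h]
      exact hA r
    · simp [hk] at h
  · have h : ∃ r', π r' = π r := ⟨r, rfl⟩
    dsimp only
    rw [dif_pos h, hcm]
    exact h.choose_spec

/-- Each class has a user whose cover mask is that class, and `π` sends the class to one such user.
A user has one mask only, so different classes get different users and the pattern is exactly `P`.
-/
theorem exists_of_covers (hk : cm k = 0)
    (hcm : ∀ l r : Fin k, (cm l).testBit r ↔ r ∈ P.part l) (hA : Covers (k + 1) cm A) :
    ∃ π : Fin k → Fin n, pattern π = P ∧ Contains A π := by
  obtain ⟨l, hl, hlA, hlc⟩ := hA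
  have hlk : ∀ j r, (cm (l j)).testBit r → l j < k := by
    intro j r h
    have : l j ≠ k := by
      intro h'
      simp [h', hk] at h
    have := hl j
    omega
  have hpart : ∀ r r', r' ∈ P.part r ↔ P.part r' = P.part r := fun r r' =>
    P.mem_part_iff_part_eq_part (Finset.mem_univ _) (Finset.mem_univ _)
  -- The choice is made per class and not per resource, so that `π` is constant on classes.
  have hex : ∀ s : {s // ∃ r, P.part r = s}, ∃ j, ∃ h : l j < k, P.part ⟨l j, h⟩ = s.1 := by
    rintro ⟨s, r, rfl⟩
    obtain ⟨j, hj⟩ := hlc r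
    exact ⟨j, hlk j r hj, ((hpart _ _).1 ((hcm ⟨l j, hlk j r hj⟩ r).1 hj)).symm⟩
  choose g hg hg' using hex
  refine ⟨fun r => g ⟨P.part r, r, rfl⟩, finpartition_eq_of_part fun r => ?_, fun r => ?_⟩
  · ext r'
    rw [mem_part_pattern, hpart]
    constructor
    · intro h
      have h1 := hg' ⟨P.part r, r, rfl⟩
      have h2 := hg' ⟨P.part r', r', rfl⟩
      simp only [← h] at h2
      exact h2.symm.trans h1
    · intro h
      simp only [h]
  · exact hlA _ r ((hcm ⟨_, hg ⟨P.part r, r, rfl⟩⟩ r).2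
      ((hpart _ _).2 (hg' ⟨P.part r, r, rfl⟩).symm))

end Pattern

/-- The covered relations are those containing some `π` with pattern `P`, so the two nested maxima
of `IsMaxOfPattern` merge into a single one over covered valid relations. -/
theorem isPatternAnswer_of_isCoverAnswer {I : Instance}
    (hI : ∀ c ∈ I.constraints, c ∈ SoDU (Fin I.k))
    {P : Finpartition (Finset.univ : Finset (Fin I.k))} {cm : ℕ → ℕ} (hk : cm I.k = 0)
    (hcm : ∀ l r : Fin I.k, (cm l).testBit r ↔ r ∈ P.part l) {a : Answer I}
    (ha : IsCoverAnswer I (I.k + 1) cm a) : IsPatternAnswer I P a := by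
  cases a with
  | none =>
    exact fun π hπ hP => ha _ hπ (covers_of_contains hk hcm hP (contains_graph π))
  | some A =>
    obtain ⟨hA, hc, hmax⟩ := ha
    obtain ⟨π, hP, hπ⟩ := exists_of_covers hk hcm hc
    refine ⟨hA, ⟨π, valid_graph hI hA hπ, hP, ⟨A, hA, hπ, rfl⟩, ?_⟩, ?_⟩
    · rintro m ⟨B, hB, hBπ, rfl⟩
      exact hmax B hB (covers_of_contains hk hcm hP hBπ)
    · rintro m ⟨π', -, hP', ⟨B, hB, hBπ, rfl⟩, -⟩
      exact hmax B hB (covers_of_contains hk hcm hP' hBπ)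

/-- The mask of the class of a resource, read from the matrix of the pattern. -/
def classMask : Term :=
  big .sum resources (Term.pow (var 0) * get 0 (lit 2 + users * resources + resources * resources +
    var 1 * resources + var 0))

theorem add_one_mul_two_pow_le (k : ℕ) :
    (((k + 1 : ℕ) : ℝ) + 1) * 2 ^ k ≤ (2 : ℝ) ^ (k : ℝ) * (4 * (k + 1)) := by
  rw [Real.rpow_natCast, mul_comm]
  push_cast
  gcongr
  have : (0 : ℝ) ≤ k := by positivity
  linarith

theorem solves_pattern_instance (I : Instance) (hI : ∀ c ∈ I.constraints, c ∈ SoDU (Fin I.k))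
    (P : Finpartition (Finset.univ : Finset (Fin I.k))) :
    ∃ (a : Answer I) (t : ℕ), IsPatternAnswer I P a ∧
      Runs (program (resources + lit 1) classMask) (encodeInstance I ++ encodePattern P)
        (encodeAnswer a) t ∧
      (t : ℝ) ≤ (2 : ℝ) ^ (I.k : ℝ) *
        (((timePoly 55 (programWeight (resources + lit 1) classMask)).eval I.size : ℕ) : ℝ) := by
  have hrest : ∀ x ∈ encodePattern P, x ≤ 1 := fun x hx => le_one_of_mem_encodeMatrix _ hx
  have hle : ∀ i, (encodePattern P).getD i 0 ≤ 1 := by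
    intro i
    rw [List.getD_eq_getElem?_getD]
    rcases h : (encodePattern P)[i]? with - | x
    · simp
    · simpa using hrest x (List.mem_of_getElem? h)
  have hget : ∀ i, (encodeInstance I ++ encodePattern P).getD (2 + I.n * I.k + I.k * I.k + i) 0 =
      (encodePattern P).getD i 0 := by
    intro i
    rw [List.getD_append_right _ _ _ _ (by rw [length_encodeInstance]; omega),
      length_encodeInstance, Nat.add_sub_cancel_left]
  set cm : ℕ → ℕ := fun l =>
    ∑ r ∈ Finset.range I.k, 2 ^ r * (encodePattern P).getD (l * I.k + r) 0 with hcmdef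
  -- Row `k` lies beyond the end of the `k × k` matrix, where the default entry `0` is read; this
  -- supplies the empty cover mask.
  have hk : cm I.k = 0 := by
    refine Finset.sum_eq_zero fun r _ => ?_
    rw [List.getD_eq_default _ _ (by rw [encodePattern, length_encodeMatrix]; omega), mul_zero]
  have hcm : ∀ l r : Fin I.k, (cm l).testBit r ↔ r ∈ P.part l := by
    intro l r
    rw [hcmdef, testBit_sum_two_pow_mul _ (fun r => hle _), encodePattern, getD_encodeMatrix]
    simp
  obtain ⟨a, c, ha, hr, hc⟩ := program_solves I hI hrest (L := I.k + 1)
    (sL := 4) (sC := 50) (cm := cm) (size := resources + lit 1) (cover := classMask)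
    (fun l _ => sum_two_pow_mul_lt _ (fun r => hle _) _)
    (fun M h ρ => by simp only [resources, eval_add, eval_get, eval_lit, h.resources])
    (fun M ρ => rfl)
    (fun M h l hl => by
      simp only [classMask, resources, users, Term.pow, eval_sum, eval_mul, eval_add, eval_get,
        eval_lit, eval_var_zero, eval_var_one, h.resources, h.users]
      refine Finset.sum_congr rfl fun r hr => ?_
      have := Finset.mem_range.1 hr
      rw [h.pow r (by omega), h.inp, ← hget, add_assoc _ (l * I.k)])
    (fun M h l hl => by
      simp only [classMask, resources, users, Term.pow, steps_big, steps_mul, steps_add, steps_get,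
        steps_lit, steps_var, eval_get, eval_lit, h.resources, Finset.sum_const,
        Finset.card_range, smul_eq_mul]
      omega)
  refine ⟨a, c, isPatternAnswer_of_isCoverAnswer hI hk hcm ha, hr, ?_⟩
  exact time_le hc (add_one_mul_two_pow_le I.k) (by positivity)

theorem solves_pattern : ∃ (c : Program) (p : Polynomial ℕ),
    ∀ q : (I : SoDUInstance) × Finpartition (Finset.univ : Finset (Fin I.1.k)),
    ∃ (a : Answer q.1.1) (t : ℕ), IsPatternAnswer q.1.1 q.2 a ∧
      Runs c (encodeInstance q.1.1 ++ encodePattern q.2) (encodeAnswer a) t ∧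
      (t : ℝ) ≤ (2 : ℝ) ^ (q.1.1.k : ℝ) * ((p.eval q.1.1.size : ℕ) : ℝ) :=
  ⟨_, _, fun q => solves_pattern_instance q.1.1 q.1.2 q.2⟩

end APEP

theorem mainTheorem3 :
    -- maxAPEP with universal separation-of-duty constraints, in time O*(2 ^ (k + k log k))
    APEP.SolvableInOStar (ι := APEP.SoDUInstance) (α := fun I => APEP.Answer I.1)
      (fun I => APEP.encodeInstance I.1) (fun _ a => APEP.encodeAnswer a)
      (fun I a => APEP.IsMaxAnswer I.1 a) (fun I => I.1.size) (fun I => I.1.k)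
      (fun k => (2 : ℝ) ^ ((k : ℝ) + (k : ℝ) * Real.logb 2 (k : ℝ))) ∧
    -- D-APEP with universal separation-of-duty constraints, in the same time
    APEP.SolvableInOStar (ι := APEP.SoDUInstance) (α := fun I => APEP.Answer I.1)
      (fun I => APEP.encodeInstance I.1) (fun _ a => APEP.encodeAnswer a)
      (fun I a => APEP.IsDecisionAnswer I.1 a) (fun I => I.1.size) (fun I => I.1.k)
      (fun k => (2 : ℝ) ^ ((k : ℝ) + (k : ℝ) * Real.logb 2 (k : ℝ))) ∧
    -- the best valid relation for a given pattern, in time O*(2 ^ k)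
    APEP.SolvableInOStar
      (ι := (I : APEP.SoDUInstance) × Finpartition (Finset.univ : Finset (Fin I.1.k)))
      (α := fun q => APEP.Answer q.1.1)
      (fun q => APEP.encodeInstance q.1.1 ++ APEP.encodePattern q.2)
      (fun _ a => APEP.encodeAnswer a)
      (fun q a => APEP.IsPatternAnswer q.1.1 q.2 a) (fun q => q.1.1.size) (fun q => q.1.1.k)
      (fun k => (2 : ℝ) ^ (k : ℝ)) := by
  refine ⟨APEP.solves_maximum, ?_, APEP.solves_pattern⟩
  obtain ⟨c, p, h⟩ := APEP.solves_maximum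
  refine ⟨c, p, fun I => ?_⟩
  obtain ⟨a, t, ha, hr, ht⟩ := h I
  refine ⟨a, t, ?_, hr, ht⟩
  cases a with
  | none => exact ha
  | some A => exact ha.1
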